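/- Let $F$ be a fixed totally real number field of degree $d$ with ring of integers $\mathcal{O}_F$. Let $Q(\mathbf{x})=\frac12\sum_{1\le i,j\le 4}a_{ij}x_ix_j$ with $a_{ij}=a_{ji}\in\mathcal{O}_F$, $a_{jj}\in 2\mathcal{O}_F$, be an integral quaternary quadratic form all of whose conjugates $Q^\sigma$ ($\sigma:F\hookrightarrow\mathbb{R}$) are positive definite. Put $A=(a_{ij})$, $\Delta=\det A$, $\mathcal{O}_F^\sharp=\{\mathbf{y}\in F^4:\mathbf{y}^tA\mathbf{x}\in\mathcal{O}_F\text{ for all }\mathbf{x}\in\mathcal{O}_F^4\}$, and let the level $\mathfrak{n}=(Q(\mathcal{O}_F^\sharp)\mathcal{O}_F)^{-1}$ be the inverse of the fractional ideal generated by the values of $Q$ on $\mathcal{O}_F^\sharp$ (it is an integral ideal). Write $r_Q(\ell)=\#\{\mathbf{x}\in\mathcal{O}_F^4:Q(\mathbf{x})=\ell\}$ and let $N$ denote the absolute norm of ideals, with $N(\Delta)=N(\Delta\mathcal{O}_F)$. Conditions $0\le\ell^\sigma\le y^{1/d}$ are understood for all embeddings $\sigma$, with $\ell\in\mathcal{O}_F$.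 Let $y,y_1,y_2>1$. (a) One has $$\sum_{0\le\ell^\sigma\le y^{1/d}} r_Q(\ell)\ll\frac{y^2}{N(\Delta)^{1/2}}+\frac{y^{3/2}}{(N(\Delta)/N(\mathfrak{n}))^{1/2}}+y,$$ where the implied constant depends only on $F$. (b) Let $K>0$ and suppose in addition that $Q$ is equivalent over $\mathcal{O}_F$ to a form $\frac12\sum b_{ij}x_ix_j=h_1(x_1+c_{12}x_2+c_{13}x_3+c_{14}x_4)^2+h_2(x_2+c_{23}x_3+c_{24}x_4)^2+h_3(x_3+c_{34}x_4)^2+h_4x_4^2$ with $c_{ij},h_j\in F$ which is reduced with constant $K$, that is, $|b_{ij}^\sigma|\le K b_{jj}^\sigma$, $b_{jj}^\sigma\le K h_j^\sigma$, $h_j^\sigma\le K b_{jj}^\sigma$ and $1\le K h_j^\sigma$ for all $i,j,\sigma$, and $h_i^\sigma\le K h_j^\tau$ for all $i\le j$ and all embeddings $\sigma,\tau$; and suppose that $h_1\asymp1$, that is, $K^{-1}\le h_1^\sigma\le K$ for all $\sigma$. Then for every $\varepsilon>0$ $$\sum_{0\le\ell_1^\sigma\le y_1^{1/d}}\ \sum_{0\le\ell_2^\sigma\le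 y_2^{1/d}} r_Q(\ell_1\ell_2^2)\ll y_1\left(\frac{(y_1y_2^2)^{3/2}}{N(\Delta)^{1/2}}+\frac{y_1y_2^2}{(N(\Delta)/N(\mathfrak{n}))^{1/2}}+(y_1y_2^2)^{1/2}\right)(y_1y_2N(\Delta))^\varepsilon,$$ $$\sum_{0\le\ell^\sigma\le y^{1/d}} r_Q(\ell^2)\ll\left(\frac{y^3}{N(\Delta)^{1/2}}+\frac{y^2}{(N(\Delta)/N(\mathfrak{n}))^{1/2}}+y\right)(y\,N(\Delta))^\varepsilon,$$ where the implied constants depend only on $F$, $K$ and $\varepsilon$. -/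

import Mathlib

open NumberField Matrix

namespace QForm

variable {F : Type*} [Field F] [NumberField F] {n : ℕ}

/-- The matrix `A` of `𝓞 F`-entries, read over `F`. -/
def toField (A : Matrix (Fin n) (Fin n) (𝓞 F)) : Matrix (Fin n) (Fin n) F :=
  A.map (algebraMap (𝓞 F) F)

/-- The conjugate `A^σ`, a real matrix. -/
def conj (σ : F →+* ℝ) (A : Matrix (Fin n) (Fin n) (𝓞 F)) : Matrix (Fin n) (Fin n) ℝ :=
  (toField A).map σ

/-- `A` is the matrix of an integral quadratic form `Q(x) = ½ ∑ a_ij x_i x_j`: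
`a_ij = a_ji ∈ 𝓞 F` and `a_jj ∈ 2 𝓞 F`. -/
structure IsIntegralForm (A : Matrix (Fin n) (Fin n) (𝓞 F)) : Prop where
  symm : A.IsSymm
  even_diag : ∀ j, (2 : 𝓞 F) ∣ A j j

/-- All conjugates of the form are positive definite. -/
def IsTotallyPosDef (A : Matrix (Fin n) (Fin n) (𝓞 F)) : Prop :=
  ∀ σ : F →+* ℝ, (conj σ A).PosDef

/-- The value `Q(x) = ½ xᵗ A x` at `x ∈ F^n`. -/
noncomputable def eval (A : Matrix (Fin n) (Fin n) (𝓞 F)) (x : Fin n → F) : F :=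
  1 / 2 * (x ⬝ᵥ (toField A *ᵥ x))

/-- The integral representations of `ℓ` by `Q`. -/
def reps (A : Matrix (Fin n) (Fin n) (𝓞 F)) (ℓ : 𝓞 F) : Set (Fin n → 𝓞 F) :=
  {x | eval A (fun i => (x i : F)) = (ℓ : F)}

/-- `r_Q(ℓ)`, the number of integral representations of `ℓ` by `Q`
(finite for totally positive definite `Q` over a totally real field, see `reps_finite`). -/
noncomputable def r (A : Matrix (Fin n) (Fin n) (𝓞 F)) (ℓ : 𝓞 F) : ℕ :=
  (reps A ℓ).ncard

/-- The dual lattice `{y ∈ F^n | 2⟨y, x⟩ = yᵗ A x ∈ 𝓞 F for all x ∈ (𝓞 F)^n}`. -/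
def dualLattice (A : Matrix (Fin n) (Fin n) (𝓞 F)) : Set (Fin n → F) :=
  {y | ∀ x : Fin n → 𝓞 F,
    y ⬝ᵥ (toField A *ᵥ fun i => (x i : F)) ∈ Set.range (algebraMap (𝓞 F) F)}

/-- The fractional ideal generated by the values of `Q` on the dual lattice. -/
noncomputable def dualValues (A : Matrix (Fin n) (Fin n) (𝓞 F)) : Submodule (𝓞 F) F :=
  Submodule.span (𝓞 F) (eval A '' dualLattice A)

/-- The level of `Q`: the inverse of the fractional ideal generated by the values of `Q` on the
dual lattice, as an integral ideal (`coe_level` shows that taking the part of the inverse inside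
`𝓞 F` loses nothing). -/
noncomputable def level (A : Matrix (Fin n) (Fin n) (𝓞 F)) : Ideal (𝓞 F) :=
  Submodule.comap (Algebra.linearMap (𝓞 F) F) (1 / dualValues A)

/-- `A` has the quasi-diagonal shape
`Q(x) = h_1 (x_1 + c_12 x_2 + ⋯)^2 + h_2 (x_2 + c_23 x_3 + ⋯)^2 + ⋯ + h_n x_n^2`, and
`a_ij^σ ≪ a_jj^σ ≍ h_j^σ`, `1 ≪ h_1^{σ_1} ≍ ⋯ ≍ h_1^{σ_d} ≪ ⋯ ≪ h_n^{σ_1} ≍ ⋯ ≍ h_n^{σ_d}`,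
all with the implied constant `K`. -/
structure IsReduced (K : ℝ) (A : Matrix (Fin n) (Fin n) (𝓞 F)) (h : Fin n → F)
    (c : Fin n → Fin n → F) : Prop where
  eval_eq : ∀ x : Fin n → F, eval A x = ∑ i, h i * (x i + ∑ j ∈ Finset.Ioi i, c i j * x j) ^ 2
  entry_le : ∀ (σ : F →+* ℝ) (i j : Fin n), |conj σ A i j| ≤ K * conj σ A j j
  diag_le : ∀ (σ : F →+* ℝ) (j : Fin n), conj σ A j j ≤ K * σ (h j)
  le_diag : ∀ (σ : F →+* ℝ) (j : Fin n), σ (h j) ≤ K * conj σ A j j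
  one_le : ∀ (σ : F →+* ℝ) (j : Fin n), 1 ≤ K * σ (h j)
  mono : ∀ (σ τ : F →+* ℝ) (i j : Fin n), i ≤ j → σ (h i) ≤ K * τ (h j)

/-- Equivalence over `𝓞 F` of the forms with matrices `A` and `B`. -/
def Equivalent (A B : Matrix (Fin n) (Fin n) (𝓞 F)) : Prop :=
  ∃ U : GL (Fin n) (𝓞 F), B = (U : Matrix (Fin n) (Fin n) (𝓞 F))ᵀ * A * U

/-- The quaternary form is equivalent to a reduced one, with implied constant `K`, in which
`h_1 ≍ 1`, i.e. `K⁻¹ ≤ h_1^σ ≤ K` for all `σ`. -/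
def FirstCoeffBounded (K : ℝ) (A : Matrix (Fin 4) (Fin 4) (𝓞 F)) : Prop :=
  ∃ (B : Matrix (Fin 4) (Fin 4) (𝓞 F)) (h : Fin 4 → F) (c : Fin 4 → Fin 4 → F),
    Equivalent A B ∧ IsReduced K B h c ∧ ∀ σ : F →+* ℝ, K⁻¹ ≤ σ (h 0) ∧ σ (h 0) ≤ K

/-- `{ℓ ∈ 𝓞 F | 0 ≤ ℓ^σ ≤ y^{1/d} for all σ}`, where `d = [F : ℚ]`. -/
def boxSet (F : Type*) [Field F] [NumberField F] (y : ℝ) : Set (𝓞 F) :=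
  {ℓ | ∀ σ : F →+* ℝ, 0 ≤ σ ℓ ∧ σ ℓ ≤ y ^ (1 / (Module.finrank ℚ F : ℝ))}

theorem finite_of_abs_le [IsTotallyReal F] (M : ℝ) :
    {x : 𝓞 F | ∀ σ : F →+* ℝ, |σ x| ≤ M}.Finite := by
  have h := Embeddings.finite_of_norm_le F ℂ M
  refine Set.Finite.of_finite_image (f := fun x : 𝓞 F => (x : F)) (h.subset ?_)
    (fun _ _ _ _ e => RingOfIntegers.ext e)
  rintro _ ⟨x, hx, rfl⟩
  refine ⟨x.2, fun φ => ?_⟩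
  have hφ : ComplexEmbedding.IsReal φ := by
    have := IsTotallyReal.isReal (K := F) (InfinitePlace.mk φ)
    exact InfinitePlace.isReal_mk_iff.mp this
  have := hx hφ.embedding
  rw [← hφ.coe_embedding_apply, Complex.norm_real]
  exact this

theorem boxSet_finite [IsTotallyReal F] (y : ℝ) : (boxSet F y).Finite :=
  (finite_of_abs_le (F := F) (y ^ (1 / (Module.finrank ℚ F : ℝ)))).subset fun x hx σ => by
    rw [abs_of_nonneg (hx σ).1]; exact (hx σ).2

/-- The finite set `{ℓ ∈ 𝓞 F | 0 ≤ ℓ^σ ≤ y^{1/d} for all σ}`. -/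
noncomputable def box (F : Type*) [Field F] [NumberField F] [IsTotallyReal F] (y : ℝ) :
    Finset (𝓞 F) :=
  (boxSet_finite (F := F) y).toFinset

theorem exists_bound_of_posDef {M : Matrix (Fin n) (Fin n) ℝ} (hM : M.PosDef) (L : ℝ) :
    ∃ T : ℝ, ∀ v : Fin n → ℝ, v ⬝ᵥ (M *ᵥ v) ≤ L → ∀ i, |v i| ≤ T := by
  have hcont : Continuous fun v : Fin n → ℝ => v ⬝ᵥ (M *ᵥ v) := by
    simp only [dotProduct, mulVec]; fun_prop
  rcases (Metric.sphere (0 : Fin n → ℝ) 1).eq_empty_or_nonempty with he | hne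
  · refine ⟨0, fun v _ i => ?_⟩
    have hv : v = 0 := by
      by_contra hv
      have : (‖v‖⁻¹ • v) ∈ Metric.sphere (0 : Fin n → ℝ) 1 := by
        simp [norm_smul, inv_mul_cancel₀ (norm_ne_zero_iff.mpr hv)]
      rw [he] at this
      exact this
    simp [hv]
  · obtain ⟨u, hu, hmin⟩ := (isCompact_sphere (0 : Fin n → ℝ) 1).exists_isMinOn hne
      hcont.continuousOn
    have hu0 : u ≠ 0 := by
      rintro rfl
      simp at hu
    have hpos : 0 < u ⬝ᵥ (M *ᵥ u) := by simpa using hM.dotProduct_mulVec_pos hu0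
    set m := u ⬝ᵥ (M *ᵥ u) with hm
    refine ⟨L / m + 1, fun v hv i => ?_⟩
    refine (norm_le_pi_norm v i).trans ?_
    by_cases hv0 : v = 0
    · subst hv0
      have hL : 0 ≤ L := by simpa using hv
      rw [norm_zero]; positivity
    have hn : 0 < ‖v‖ := norm_pos_iff.mpr hv0
    have hmem : (‖v‖⁻¹ • v) ∈ Metric.sphere (0 : Fin n → ℝ) 1 := by
      simp [norm_smul, inv_mul_cancel₀ hn.ne']
    have h1 : m ≤ (‖v‖⁻¹ • v) ⬝ᵥ (M *ᵥ (‖v‖⁻¹ • v)) := hmin hmem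
    rw [mulVec_smul, smul_dotProduct, dotProduct_smul, smul_eq_mul, smul_eq_mul] at h1
    have h2 : m * ‖v‖ ^ 2 ≤ L := by
      have : ‖v‖⁻¹ * (‖v‖⁻¹ * (v ⬝ᵥ (M *ᵥ v))) * ‖v‖ ^ 2 = v ⬝ᵥ (M *ᵥ v) := by
        field_simp
      nlinarith [mul_le_mul_of_nonneg_right h1 (sq_nonneg ‖v‖)]
    have h3 : ‖v‖ ^ 2 ≤ L / m := by rw [le_div_iff₀ hpos]; linarith
    nlinarith [sq_nonneg (‖v‖ - 1)]

theorem conj_eval (σ : F →+* ℝ) (A : Matrix (Fin n) (Fin n) (𝓞 F)) (x : Fin n → F) :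
    (fun i => σ (x i)) ⬝ᵥ (conj σ A *ᵥ fun i => σ (x i)) = 2 * σ (eval A x) := by
  simp only [eval, map_mul, map_div₀, map_one, map_ofNat, dotProduct, mulVec, conj, map_sum,
    Matrix.map_apply]
  ring

theorem reps_finite [IsTotallyReal F] {A : Matrix (Fin n) (Fin n) (𝓞 F)}
    (hA : IsTotallyPosDef A) (ℓ : 𝓞 F) : (reps A ℓ).Finite := by
  have hfin : Finite (F →+* ℝ) :=
    Finite.of_injective (fun σ : F →+* ℝ => Complex.ofRealHom.comp σ) fun σ τ h => by
      ext x
      exact Complex.ofReal_injective (RingHom.congr_fun h x)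
  choose T hT using fun σ : F →+* ℝ => exists_bound_of_posDef (hA σ) (2 * σ ℓ)
  obtain ⟨M, hM⟩ := (Set.finite_range T).bddAbove
  refine (Set.Finite.pi' fun _ : Fin n => finite_of_abs_le (F := F) M).subset fun x hx i σ => ?_
  refine (hT σ (fun i => σ (x i)) ?_ i).trans (hM ⟨σ, rfl⟩)
  rw [conj_eval σ A (fun i => (x i : F)), show eval A (fun i => (x i : F)) = (ℓ : F) from hx]

theorem coe_level {A : Matrix (Fin n) (Fin n) (𝓞 F)} (hn : 0 < n) (hA : IsIntegralForm A)
    (hdet : A.det ≠ 0) :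
    Submodule.map (Algebra.linearMap (𝓞 F) F) (level A) = 1 / dualValues A := by
  rw [level, Submodule.map_comap_eq, inf_eq_right]
  intro N hN
  rw [Submodule.mem_div_iff_forall_mul_mem] at hN
  have hN' : ∀ y ∈ dualLattice A, ∃ a : 𝓞 F, (a : F) = N * eval A y := fun y hy => by
    have := hN _ (Submodule.subset_span ⟨y, hy, rfl⟩)
    simpa [Submodule.mem_one] using this
  have hd : (toField A).det ≠ 0 := by
    rw [toField, ← RingHom.mapMatrix_apply, ← RingHom.map_det]
    simpa using hdet
  have hu : IsUnit (toField A).det := isUnit_iff_ne_zero.mpr hd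
  have hs : (toField A)ᵀ = toField A := by
    rw [toField, ← Matrix.transpose_map, hA.symm.eq]
  have hadd : ∀ y z : Fin n → F, y ∈ dualLattice A → z ∈ dualLattice A →
      y + z ∈ dualLattice A := by
    intro y z hy hz x
    obtain ⟨a, ha⟩ := hy x
    obtain ⟨b, hb⟩ := hz x
    exact ⟨a + b, by rw [map_add, ha, hb, add_dotProduct]⟩
  have hpol : ∀ y z : Fin n → F, y ∈ dualLattice A → z ∈ dualLattice A →
      ∃ a : 𝓞 F, (a : F) = N * (y ⬝ᵥ (toField A *ᵥ z)) := by
    intro y z hy hz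
    obtain ⟨a, ha⟩ := hN' _ (hadd y z hy hz)
    obtain ⟨b, hb⟩ := hN' _ hy
    obtain ⟨c, hc⟩ := hN' _ hz
    refine ⟨a - b - c, ?_⟩
    have hcomm : z ⬝ᵥ (toField A *ᵥ y) = y ⬝ᵥ (toField A *ᵥ z) := by
      rw [dotProduct_mulVec, ← mulVec_transpose, hs, dotProduct_comm]
    rw [show ((a - b - c : 𝓞 F) : F) = (a : F) - b - c by simp, ha, hb, hc, eval, eval, eval, mulVec_add, add_dotProduct,
      dotProduct_add, dotProduct_add, hcomm]
    ring
  let e : Fin n → 𝓞 F := Pi.single ⟨0, hn⟩ 1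
  have he : (fun i => (e i : F)) ∈ dualLattice A := by
    intro x
    refine ⟨e ⬝ᵥ (A *ᵥ x), ?_⟩
    simp only [dotProduct, mulVec, toField, map_sum, map_mul, Matrix.map_apply]
  have hy (w : Fin n → F) : (toField A)⁻¹ *ᵥ (fun i => (e i : F)) ⬝ᵥ (toField A *ᵥ w)
      = w ⟨0, hn⟩ := by
    rw [dotProduct_mulVec, ← mulVec_transpose, hs, mulVec_mulVec, mul_nonsing_inv _ hu,
      one_mulVec]
    have : (fun i => (e i : F)) = Pi.single ⟨0, hn⟩ 1 := by
      funext i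
      by_cases hi : i = ⟨0, hn⟩
      · subst hi; simp [e]
      · simp [e, hi]
    rw [this, single_one_dotProduct]
  obtain ⟨a, ha⟩ := hpol _ _ (fun x => ⟨x ⟨0, hn⟩, (hy fun i => (x i : F)).symm⟩) he
  refine ⟨a, ?_⟩
  rw [hy] at ha
  simpa [e] using ha

/-- The absolute norm of the determinant `Δ = det A`. -/
noncomputable def normDet (A : Matrix (Fin n) (Fin n) (𝓞 F)) : ℝ :=
  (Ideal.absNorm (Ideal.span {A.det}) : ℝ)

/-- The absolute norm of the level. -/
noncomputable def normLevel (A : Matrix (Fin n) (Fin n) (𝓞 F)) : ℝ :=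
  (Ideal.absNorm (level A) : ℝ)

end QForm

/-!
Both bounds come from counting integral vectors in the box `Q^σ(x) ≤ Y`, `Y = y^{1/d}`; neither
reduction theory nor volumes are used for the first.

For the first bound, let `k` be the rank of the `F`-span of the integral vectors in the box. By
induction on `k`, projecting orthogonally to a hyperplane spanned by vectors of the box and applying
the pigeonhole principle to the coordinate along its normal, there are `k` integral vectors spanning
the same space whose Gram determinant `g` satisfies `#² · N(g) ≪ y^k`
(`exists_card_sq_mul_absN_det_le`). So a lower bound for `N(g)` is an upper bound for the count.
If `k ≤ 2`, then `N(g) ≥ 1`, as `g` is a nonzero integer. If `k = 4`, then `g` is `Δ` times a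
square. If `k = 3`, then `g = 2 Δ Q(w)`, where `w` is the vector of the dual lattice obtained by
applying `A⁻¹` to the `3 × 3` minors; since `Q(w) 𝔫` is integral, `N(g) ≥ N(Δ) / N(𝔫)`
(`QForm.absN_two_mul_normDet_le`).

For the other bounds the form may be taken reduced. The last three coordinates run through boxes
with comparable sides, and `N(h₁ h₂ h₃ h₄) ≍ N(Δ)` and `N(h₁ h₂ h₃) ≫ N(Δ) / N(𝔫)`, by the same
argument as before, give the three terms (`QForm.exists_boxSize_mul_le`). Once those coordinates and
`ℓ₁` are fixed, completing the square turns `Q(x) = ℓ₁ ℓ₂²` into `D ℓ₂² - u² = m` with `m` totally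
positive, unless the three coordinates vanish. Its solutions inject into the divisors `√D ℓ₂ - u` of
`m` in `F(√D)`, and divisors of bounded size are `≪ y^ε` in number, uniformly in number fields of
bounded degree (`NumberField.exists_card_divisors_le`): there are few ideals dividing `m`, few
choices for the sizes up to a factor `2`, and units that are bounded under all embeddings are
determined by their residues modulo `5`.
-/

/-! ### Norms and pigeonhole in number fields -/

namespace NumberField

section Complex

variable {E : Type*} [Field E] [NumberField E]

theorem prod_norm_embeddings (x : E) : ∏ φ : E →+* ℂ, ‖φ x‖ = |(Algebra.norm ℚ x : ℝ)| := by
  have h := congr_arg (‖·‖) (Algebra.norm_eq_prod_embeddings ℚ ℂ x)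
  rw [norm_prod, ← Fintype.prod_equiv (RingHom.equivRatAlgHom E ℂ) (fun f => ‖f x‖)
      (fun φ => ‖φ x‖) fun _ => by simp [RingHom.equivRatAlgHom_apply]] at h
  rw [← h, eq_ratCast, Complex.norm_ratCast]

theorem absNorm_span_eq_prod (a : 𝓞 E) :
    (Ideal.absNorm (Ideal.span {a}) : ℝ) = ∏ φ : E →+* ℂ, ‖φ a‖ := by
  rw [Ideal.absNorm_span_singleton, prod_norm_embeddings, ← Algebra.coe_norm_int]
  simp [Nat.cast_natAbs]

theorem one_le_prod_norm {a : 𝓞 E} (ha : a ≠ 0) : 1 ≤ ∏ φ : E →+* ℂ, ‖φ a‖ := by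
  rw [← absNorm_span_eq_prod, Nat.one_le_cast, Nat.one_le_iff_ne_zero, Ne,
    Ideal.absNorm_eq_zero_iff, Ideal.span_singleton_eq_bot]
  exact ha

theorem eq_zero_of_norm_lt_one {a : 𝓞 E} (h : ∀ φ : E →+* ℂ, ‖φ a‖ < 1) : a = 0 := by
  by_contra ha
  have φ₀ : E →+* ℂ := Classical.arbitrary _
  refine absurd (one_le_prod_norm ha) (not_le.mpr ?_)
  have h0 : ∀ φ : E →+* ℂ, 0 < ‖φ a‖ := fun φ => by simpa using ha
  calc ∏ φ : E →+* ℂ, ‖φ a‖ < ∏ φ : E →+* ℂ, (1 : ℝ) :=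
        Finset.prod_lt_prod_of_nonempty (fun φ _ => h0 φ) (fun φ _ => h φ) ⟨φ₀, Finset.mem_univ _⟩
    _ = 1 := by simp

end Complex

variable {F : Type*} [Field F] [NumberField F]

/-- The absolute value of the norm of an element of a totally real field, as the product of its
absolute values under all real embeddings. -/
noncomputable def absN (x : F) : ℝ := ∏ σ : F →+* ℝ, |σ x|

theorem absN_mul (x y : F) : absN (x * y) = absN x * absN y := by
  simp [absN, abs_mul, Finset.prod_mul_distrib]

theorem absN_nonneg (x : F) : 0 ≤ absN x := Finset.prod_nonneg fun _ _ => abs_nonneg _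

theorem absN_one : absN (1 : F) = 1 := by simp [absN]

theorem absN_sq (x : F) : absN (x ^ 2) = absN x ^ 2 := by rw [sq, absN_mul, sq]

theorem absN_natCast (m : ℕ) : absN (m : F) = (m : ℝ) ^ Fintype.card (F →+* ℝ) := by
  simp [absN]

section TotallyReal

variable [IsTotallyReal F]

variable (F) in
/-- Over a totally real field, every complex embedding is real. -/
noncomputable def realEmbeddingEquiv : (F →+* ℝ) ≃ (F →+* ℂ) where
  toFun σ := Complex.ofRealHom.comp σ
  invFun φ := (IsTotallyReal.complexEmbedding_isReal φ).embedding
  left_inv σ := by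
    ext x
    apply Complex.ofReal_injective
    rw [ComplexEmbedding.IsReal.coe_embedding_apply]
    rfl
  right_inv φ := by
    ext x
    exact ComplexEmbedding.IsReal.coe_embedding_apply _ x

omit [NumberField F] in
theorem realEmbeddingEquiv_apply (σ : F →+* ℝ) (x : F) :
    realEmbeddingEquiv F σ x = (σ x : ℂ) := rfl

omit [NumberField F] in
theorem norm_embedding (φ : F →+* ℂ) (x : F) : ‖φ x‖ = |(realEmbeddingEquiv F).symm φ x| := by
  conv_lhs => rw [← (realEmbeddingEquiv F).apply_symm_apply φ, realEmbeddingEquiv_apply]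
  simp

theorem card_realEmbeddings : Fintype.card (F →+* ℝ) = Module.finrank ℚ F := by
  rw [Fintype.card_congr (realEmbeddingEquiv F), Embeddings.card F ℂ]

instance : Nonempty (F →+* ℝ) := ⟨(realEmbeddingEquiv F).symm (Classical.arbitrary _)⟩

theorem absN_eq_prod_norm (x : F) : absN x = ∏ φ : F →+* ℂ, ‖φ x‖ :=
  Fintype.prod_equiv (realEmbeddingEquiv F) _ _ fun σ => by simp [realEmbeddingEquiv_apply]

theorem absN_eq_absNorm (a : 𝓞 F) : absN (a : F) = Ideal.absNorm (Ideal.span {a}) := by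
  rw [absN_eq_prod_norm, absNorm_span_eq_prod]

theorem one_le_absN {a : 𝓞 F} (ha : a ≠ 0) : 1 ≤ absN (a : F) := by
  rw [absN_eq_prod_norm]; exact one_le_prod_norm ha

theorem eq_of_abs_sub_lt_one {a b : 𝓞 F} (h : ∀ σ : F →+* ℝ, |σ a - σ b| < 1) : a = b := by
  rw [← sub_eq_zero]
  refine eq_zero_of_norm_lt_one fun φ => ?_
  rw [norm_embedding]
  simpa using h ((realEmbeddingEquiv F).symm φ)

/-- A box with sides `2 R_σ` is covered by `∏ ⌊2 R_σ + 1⌋` half-open unit boxes, and such a box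
holds at most one integer. -/
theorem card_le_of_abs_sub_le (T : Finset (𝓞 F)) (ρ R : (F →+* ℝ) → ℝ)
    (hR : ∀ σ, 0 ≤ R σ) (h : ∀ a ∈ T, ∀ σ : F →+* ℝ, |σ a - ρ σ| ≤ R σ) :
    (T.card : ℝ) ≤ ∏ σ : F →+* ℝ, (2 * R σ + 1) := by
  classical
  let f : 𝓞 F → (F →+* ℝ) → ℕ := fun a σ => ⌊σ a - ρ σ + R σ⌋₊
  have hpos : ∀ a ∈ T, ∀ σ : F →+* ℝ, 0 ≤ σ a - ρ σ + R σ := fun a ha σ => by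
    have := (abs_le.mp (h a ha σ)).1; linarith
  have hcard : T.card ≤ (Fintype.piFinset fun σ => Finset.range (⌊2 * R σ⌋₊ + 1)).card := by
    refine Finset.card_le_card_of_injOn f (fun a ha => ?_) fun a ha b hb hab => ?_
    · simp only [Finset.mem_coe, Fintype.mem_piFinset, Finset.mem_range, f]
      intro σ
      refine Nat.lt_succ_of_le (Nat.floor_le_floor ?_)
      have := (abs_le.mp (h a ha σ)).2; linarith
    · refine eq_of_abs_sub_lt_one fun σ => ?_
      have h1 := congr_fun hab σ
      simp only [f] at h1
      have ha1 := Nat.floor_le (hpos a ha σ)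
      have ha2 := Nat.lt_floor_add_one (σ a - ρ σ + R σ)
      have hb1 := Nat.floor_le (hpos b hb σ)
      have hb2 := Nat.lt_floor_add_one (σ b - ρ σ + R σ)
      rw [h1] at ha1 ha2
      rw [abs_lt]; constructor <;> linarith
  rw [Fintype.card_piFinset] at hcard
  calc (T.card : ℝ) ≤ ((∏ σ : F →+* ℝ, (Finset.range (⌊2 * R σ⌋₊ + 1)).card : ℕ) : ℝ) := by
        exact_mod_cast hcard
    _ = ∏ σ : F →+* ℝ, ((⌊2 * R σ⌋₊ : ℝ) + 1) := by push_cast [Finset.card_range]; rfl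
    _ ≤ _ := Finset.prod_le_prod (fun σ _ => by positivity) fun σ _ => by
        have := Nat.floor_le (show 0 ≤ 2 * R σ by linarith [hR σ]); linarith

/-- Pigeonhole: among many elements of a box, two have a difference of small norm. -/
theorem exists_absN_sub_mul_card_le (T : Finset F) (hT : 1 < T.card) (R : (F →+* ℝ) → ℝ)
    (h : ∀ t ∈ T, ∀ σ : F →+* ℝ, |σ t| ≤ R σ) :
    ∃ s ∈ T, ∃ t ∈ T, s ≠ t ∧
      absN (s - t) * T.card ≤ 8 ^ Fintype.card (F →+* ℝ) * ∏ σ : F →+* ℝ, R σ := by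
  classical
  set d := Fintype.card (F →+* ℝ) with hd
  have hd0 : d ≠ 0 := Fintype.card_ne_zero
  have hR : ∀ σ, 0 < R σ := by
    intro σ
    obtain ⟨s, hs, t, ht, hst⟩ := Finset.one_lt_card.mp hT
    by_contra! hσ
    have h1 : σ s = 0 := abs_nonpos_iff.mp ((h s hs σ).trans hσ)
    have h2 : σ t = 0 := abs_nonpos_iff.mp ((h t ht σ).trans hσ)
    exact hst (σ.injective (h1.trans h2.symm))
  -- `q` is the largest number of pieces per side for which the pigeonhole principle applies
  obtain ⟨q, hq1, hq2⟩ : ∃ q : ℕ, q ^ d < T.card ∧ T.card ≤ (q + 1) ^ d := by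
    have hex : ∃ m : ℕ, T.card ≤ (m + 1) ^ d :=
      ⟨T.card, (Nat.le_succ _).trans (Nat.le_self_pow hd0 _)⟩
    refine ⟨Nat.find hex, ?_, Nat.find_spec hex⟩
    rcases Nat.eq_zero_or_pos (Nat.find hex) with h0 | h0
    · rw [h0, zero_pow hd0]; omega
    · have := Nat.find_min hex (Nat.sub_lt h0 one_pos)
      rw [show Nat.find hex - 1 + 1 = Nat.find hex by omega] at this
      omega
  have hq0 : 0 < q := by
    rcases Nat.eq_zero_or_pos q with rfl | h0
    · simp at hq2; omega
    · exact h0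
  have hq0' : (0 : ℝ) < q := by exact_mod_cast hq0
  let f : F → (F →+* ℝ) → ℕ := fun t σ => ⌊q * ((σ t + R σ) / (4 * R σ))⌋₊
  have hpos : ∀ t ∈ T, ∀ σ : F →+* ℝ, 0 ≤ q * ((σ t + R σ) / (4 * R σ)) := fun t ht σ => by
    have := (abs_le.mp (h t ht σ)).1
    have := hR σ
    exact mul_nonneg hq0'.le (div_nonneg (by linarith) (by linarith))
  obtain ⟨s, hs, t, ht, hst, hf⟩ := Finset.exists_ne_map_eq_of_card_lt_of_maps_to (s := T)
    (t := Fintype.piFinset fun _ : F →+* ℝ => Finset.range q) (f := f)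
    (by simpa [Fintype.card_piFinset] using hq1) (fun t ht => by
      simp only [Finset.mem_coe, Fintype.mem_piFinset, Finset.mem_range, f]
      intro σ
      rw [Nat.floor_lt (hpos t ht σ)]
      have h1 := (abs_le.mp (h t ht σ)).2
      have h2 := hR σ
      have : (σ t + R σ) / (4 * R σ) < 1 := by rw [div_lt_one (by linarith)]; linarith
      nlinarith)
  refine ⟨s, hs, t, ht, hst, ?_⟩
  have hdiff : ∀ σ : F →+* ℝ, |σ (s - t)| ≤ 4 * R σ / q := by
    intro σ
    have h1 := congr_fun hf σ
    simp only [f] at h1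
    have ha1 := Nat.floor_le (hpos s hs σ)
    have ha2 := Nat.lt_floor_add_one (q * ((σ s + R σ) / (4 * R σ)))
    have hb1 := Nat.floor_le (hpos t ht σ)
    have hb2 := Nat.lt_floor_add_one (q * ((σ t + R σ) / (4 * R σ)))
    rw [h1] at ha1 ha2
    have h4 : 0 < 4 * R σ := by linarith [hR σ]
    have e : q * ((σ s + R σ) / (4 * R σ)) - q * ((σ t + R σ) / (4 * R σ))
        = σ (s - t) * (q / (4 * R σ)) := by rw [map_sub]; field_simp; ring
    have h5 : |σ (s - t) * (q / (4 * R σ))| ≤ 1 := by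
      rw [← e, abs_le]; constructor <;> linarith
    rw [abs_mul, abs_of_pos (div_pos hq0' h4)] at h5
    rw [le_div_iff₀ hq0']
    rw [mul_div_assoc', div_le_one h4] at h5
    exact h5
  have hN : absN (s - t) ≤ (∏ σ : F →+* ℝ, R σ) * 4 ^ d / q ^ d := by
    calc absN (s - t) ≤ ∏ σ : F →+* ℝ, (4 * R σ / q) :=
          Finset.prod_le_prod (fun _ _ => abs_nonneg _) fun σ _ => hdiff σ
      _ = _ := by
        rw [Finset.prod_div_distrib, Finset.prod_mul_distrib, Finset.prod_const, Finset.prod_const,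
          Finset.card_univ, mul_comm]
  have hc : (T.card : ℝ) ≤ 2 ^ d * q ^ d := by
    calc (T.card : ℝ) ≤ ((q : ℝ) + 1) ^ d := by exact_mod_cast hq2
      _ ≤ (2 * q) ^ d := by
        gcongr
        have : (1 : ℝ) ≤ q := by exact_mod_cast hq0
        linarith
      _ = _ := mul_pow _ _ _
  calc absN (s - t) * T.card ≤ ((∏ σ : F →+* ℝ, R σ) * 4 ^ d / q ^ d) * (2 ^ d * q ^ d) :=
        mul_le_mul hN hc (by positivity) ((absN_nonneg _).trans hN)
    _ = (4 ^ d * 2 ^ d) * ∏ σ : F →+* ℝ, R σ := by field_simp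
    _ = _ := by rw [← mul_pow]; norm_num

end TotallyReal

end NumberField

/-! ### Counting lattice points by Gram determinants -/

section GramDet

variable {K V : Type*} [Field K] [AddCommGroup V] [Module K V]

/-- The Gram matrix of a family of vectors with respect to a bilinear form. -/
def bilinGram (B : LinearMap.BilinForm K V) {k : ℕ} (u : Fin k → V) : Matrix (Fin k) (Fin k) K :=
  Matrix.of fun i j => B (u i) (u j)

/-- Adding to a family the vector `w + c p`, with `w` in its span and `p` orthogonal to it,
multiplies the Gram determinant by `c² B(p, p)`. -/
theorem det_bilinGram_cons {B : LinearMap.BilinForm K V} (hB : B.IsSymm) {k : ℕ} (u : Fin k → V)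
    {w p : V} (c : K) (hw : w ∈ Submodule.span K (Set.range u)) (hp : ∀ i, B p (u i) = 0) :
    (bilinGram B (Fin.cons (w + c • p) u : Fin (k + 1) → V)).det
      = c ^ 2 * B p p * (bilinGram B u).det := by
  obtain ⟨a, rfl⟩ := (Submodule.mem_span_range_iff_exists_fun K).mp hw
  have hp' : ∀ i, B (u i) p = 0 := fun i => by rw [hB.eq, hp]
  let E : Matrix (Fin (k + 1)) (Fin (k + 1)) K :=
    Matrix.of (Fin.cons (Fin.cons c 0) fun i => Fin.cons (a i) (Pi.single i 1))
  have hE : E.det = c := by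
    rw [Matrix.det_succ_row_zero, Fin.sum_univ_succ]
    have h1 : E.submatrix Fin.succ Fin.succ = 1 := by
      ext i j
      simp [E, Matrix.one_apply, Pi.single_apply, eq_comm]
    simp [E, h1]
  have hG : bilinGram B (Fin.cons (∑ i, a i • u i + c • p) u : Fin (k + 1) → V)
      = Eᵀ * bilinGram B (Fin.cons p u : Fin (k + 1) → V) * E := by
    ext i j
    refine Fin.cases ?_ (fun i => ?_) i <;> refine Fin.cases ?_ (fun j => ?_) j <;>
    simp [E, bilinGram, Matrix.mul_apply, Fin.sum_univ_succ, hp, hp', Pi.single_apply,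
      Finset.sum_mul, Finset.mul_sum]
    · rw [Finset.sum_comm, add_comm]
      congr 1
      · ring
      · exact Finset.sum_congr rfl fun x _ => Finset.sum_congr rfl fun y _ => by
          rw [hB.eq]; ring
    · exact Finset.sum_congr rfl fun x _ => mul_comm _ _
  have h0 : (bilinGram B (Fin.cons p u : Fin (k + 1) → V)).det = B p p * (bilinGram B u).det := by
    rw [Matrix.det_succ_row_zero, Fin.sum_univ_succ]
    have h1 : (bilinGram B (Fin.cons p u : Fin (k + 1) → V)).submatrix Fin.succ Fin.succ
      = bilinGram B u := by
      ext i j; simp [bilinGram]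
    have h2 : ∀ j : Fin k, bilinGram B (Fin.cons p u : Fin (k + 1) → V) 0 j.succ = 0 := by
      simp [bilinGram, hp]
    have h3 : bilinGram B (Fin.cons p u : Fin (k + 1) → V) 0 0 = B p p := by simp [bilinGram]
    simp only [Fin.succAbove_zero, h1, h2, h3]
    simp
  rw [hG, Matrix.det_mul, Matrix.det_mul, Matrix.det_transpose, hE, h0]
  ring
end GramDet

section Count

variable {F : Type*} [Field F] [NumberField F] [IsTotallyReal F]

universe v

theorem sq_mul_le_of_le_mul {S s g c b D X Z : ℝ} (hS0 : 0 ≤ S) (hS : S ≤ s * g) (hD : 0 ≤ D)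
    (hc : 0 ≤ c) (hb : 0 ≤ b) (hX : g ^ 2 * c * b ≤ X) (hZ : s ^ 2 * D ≤ Z) (hX0 : 0 ≤ X) :
    S ^ 2 * (c * b * D) ≤ X * Z :=
  calc S ^ 2 * (c * b * D) ≤ (s * g) ^ 2 * (c * b * D) :=
        mul_le_mul_of_nonneg_right (pow_le_pow_left₀ hS0 hS 2) (by positivity)
    _ = (g ^ 2 * c * b) * (s ^ 2 * D) := by ring
    _ ≤ X * Z := mul_le_mul hX hZ (by positivity) hX0

variable (F) in
set_option maxHeartbeats 400000 in
/-- The number of points of a lattice `Λ` in the span of `v₁, …, v_k ∈ Λ` and in the box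
`B(x, x)^σ ≤ Y` is controlled by the norm of the Gram determinant of a suitable basis. -/
theorem exists_card_sq_mul_absN_det_le (k : ℕ) : ∃ C : ℝ, 0 < C ∧
    ∀ (V : Type v) [AddCommGroup V] [Module F V] [FiniteDimensional F V]
      (B : LinearMap.BilinForm F V) (_ : B.IsSymm)
      (_ : ∀ (σ : F →+* ℝ) (x : V), x ≠ 0 → 0 < σ (B x x)) (Λ : AddSubgroup V) (Y : ℝ)
      (v : Fin k → V) (_ : LinearIndependent F v) (_ : ∀ i, v i ∈ Λ)
      (_ : ∀ (i) (σ : F →+* ℝ), σ (B (v i) (v i)) ≤ Y) (S : Finset V)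
      (_ : ∀ x ∈ S, x ∈ Λ ∧ x ∈ Submodule.span F (Set.range v) ∧ ∀ σ : F →+* ℝ, σ (B x x) ≤ Y),
      ∃ u : Fin k → V, (∀ i, u i ∈ Λ) ∧
        Submodule.span F (Set.range u) = Submodule.span F (Set.range v) ∧
        (bilinGram B u).det ≠ 0 ∧
        (S.card : ℝ) ^ 2 * absN (bilinGram B u).det ≤ C * (Y ^ k) ^ Fintype.card (F →+* ℝ) := by
  classical
  set d := Fintype.card (F →+* ℝ) with hd
  induction k with
  | zero =>
    refine ⟨1, one_pos, fun V _ _ _ B hB hpos Λ Y v hv hvΛ hvY S hS => ⟨v, hvΛ, rfl, by simp, ?_⟩⟩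
    have hcard : S.card ≤ 1 := by
      refine Finset.card_le_one.mpr fun x hx y hy => ?_
      have hx' := (hS x hx).2.1
      have hy' := (hS y hy).2.1
      rw [Set.range_eq_empty v, Submodule.span_empty, Submodule.mem_bot] at hx' hy'
      rw [hx', hy']
    have : (S.card : ℝ) ≤ 1 := by exact_mod_cast hcard
    simp only [Matrix.det_isEmpty, absN_one, pow_zero, one_pow, mul_one]
    exact pow_le_one₀ (by positivity) this
  | succ k ih =>
    obtain ⟨C, hC, ih⟩ := ih
    refine ⟨C * (4 ^ k) ^ d * 64 ^ d, by positivity,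
      fun V _ _ _ B hB hpos Λ Y v hv hvΛ hvY S hS => ?_⟩
    -- enlarge `S` so that the coordinate along `v 0` takes at least two values
    wlog h0S : 0 ∈ S ∧ v 0 ∈ S generalizing S with H
    · have σ₀ : F →+* ℝ := Classical.arbitrary _
      have hY : 0 ≤ Y := ((hpos σ₀ _ (hv.ne_zero 0)).trans_le (hvY 0 σ₀)).le
      obtain ⟨u, h1, h2, h3, h4⟩ := H (insert 0 (insert (v 0) S)) (fun x hx => by
        rcases Finset.mem_insert.mp hx with rfl | hx
        · exact ⟨Λ.zero_mem, Submodule.zero_mem _, fun σ => by simpa using hY⟩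
        rcases Finset.mem_insert.mp hx with rfl | hx
        · exact ⟨hvΛ 0, Submodule.subset_span ⟨0, rfl⟩, hvY 0⟩
        · exact hS x hx) (by simp)
      refine ⟨u, h1, h2, h3, le_trans ?_ h4⟩
      have hc : (S.card : ℝ) ≤ (insert 0 (insert (v 0) S)).card :=
        Nat.cast_le.mpr (Finset.card_le_card fun x hx =>
          Finset.mem_insert_of_mem (Finset.mem_insert_of_mem hx))
      exact mul_le_mul_of_nonneg_right (pow_le_pow_left₀ (Nat.cast_nonneg _) hc 2) (absN_nonneg _)
    obtain ⟨h0S, hvS⟩ := h0S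
    set W := Submodule.span F (Set.range (Fin.tail v)) with hW
    have hanis : ∀ x : V, B x x = 0 → x = 0 := fun x hx => by
      by_contra hx0
      have σ₀ : F →+* ℝ := Classical.arbitrary _
      have := hpos σ₀ x hx0
      rw [hx, map_zero] at this
      exact lt_irrefl _ this
    have hnonneg : ∀ (σ : F →+* ℝ) (x : V), 0 ≤ σ (B x x) := fun σ x => by
      by_cases hx : x = 0
      · simp [hx]
      · exact (hpos σ x hx).le
    rw [linearIndependent_finSucc] at hv
    obtain ⟨hvt, hv0⟩ := hv
    have hcompl : IsCompl W (B.orthogonal W) := by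
      refine LinearMap.BilinForm.isCompl_orthogonal_of_restrict_nondegenerate hB.isRefl ⟨?_, ?_⟩ <;>
      · intro x hx
        exact Subtype.ext (hanis x (hx x))
    obtain ⟨w₀, hw₀, p, hp, hwp⟩ := Submodule.mem_sup.mp
      (hcompl.sup_eq_top.ge (Submodule.mem_top : v 0 ∈ ⊤))
    have hpW : ∀ w ∈ W, B p w = 0 := fun w hw => by
      rw [hB.eq]; exact LinearMap.BilinForm.mem_orthogonal_iff.mp hp w hw
    have hp0 : p ≠ 0 := by
      rintro rfl
      rw [add_zero] at hwp
      exact hv0 (hwp ▸ hw₀)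
    have hpp : B p p ≠ 0 := fun h => hp0 (hanis p h)
    set c : V → F := fun x => B p x / B p p with hc
    have hspan : ∀ x, x ∈ Submodule.span F (Set.range v) ↔ x - c x • p ∈ W := by
      intro x
      rw [← Fin.cons_self_tail v, Fin.range_cons, Submodule.mem_span_insert]
      constructor
      · rintro ⟨a, z, hz, rfl⟩
        have : c (a • v 0 + z) = a := by
          simp only [hc, ← hwp, map_add, map_smul, smul_eq_mul, hpW w₀ hw₀, hpW z hz]
          field_simp
          ring
        rw [this, ← hwp, show a • (w₀ + p) + z - a • p = a • w₀ + z by rw [smul_add]; abel]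
        exact W.add_mem (W.smul_mem _ hw₀) hz
      · intro h
        refine ⟨c x, x - c x • p - c x • w₀, W.sub_mem h (W.smul_mem _ hw₀), ?_⟩
        rw [← hwp, smul_add]; abel
    have hcbound : ∀ x ∈ S, ∀ σ : F →+* ℝ, |σ (c x)| ≤ √(Y / σ (B p p)) := by
      intro x hx σ
      obtain ⟨-, hxs, hxY⟩ := hS x hx
      have hw := (hspan x).mp hxs
      set w := x - c x • p with hwdef
      have hxw : x = w + c x • p := by rw [hwdef]; abel
      have e : B x x = B w w + c x ^ 2 * B p p := by
        conv_lhs => rw [hxw]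
        have h1 := hpW w hw
        have h2 : B w p = 0 := by rw [hB.eq]; exact h1
        simp only [map_add, map_smul, LinearMap.add_apply, LinearMap.smul_apply, smul_eq_mul, h1, h2]
        ring
      have h1 := hxY σ
      rw [e, map_add, map_mul, map_pow] at h1
      have h2 := hnonneg σ w
      have h3 := hpos σ p hp0
      apply Real.abs_le_sqrt
      rw [le_div_iff₀ h3]
      linarith
    set g := (S.image c).card with hg
    have hg1 : 1 < g := by
      refine Finset.one_lt_card.mpr ⟨c 0, Finset.mem_image_of_mem _ h0S, c (v 0),
        Finset.mem_image_of_mem _ hvS, ?_⟩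
      have : c (v 0) = 1 := by
        simp only [hc, ← hwp, map_add, hpW w₀ hw₀, zero_add, div_self hpp]
      rw [this]
      simp [hc]
    obtain ⟨_, hs, _, ht, hst, hNst⟩ := exists_absN_sub_mul_card_le (S.image c) hg1
      (fun σ => √(Y / σ (B p p))) (by
        intro t ht
        obtain ⟨x, hx, rfl⟩ := Finset.mem_image.mp ht
        exact hcbound x hx)
    obtain ⟨s, hsS, rfl⟩ := Finset.mem_image.mp hs
    obtain ⟨t, htS, rfl⟩ := Finset.mem_image.mp ht
    have hcst : c s - c t = c (s - t) := by simp only [hc, map_sub]; ring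
    rw [hcst, ← hg, ← hd] at hNst
    -- a largest fibre of the coordinate
    obtain ⟨b, hb, hmax⟩ := (S.image c).exists_max_image (fun b => {x ∈ S | c x = b}.card)
      ⟨_, Finset.mem_image_of_mem _ h0S⟩
    have hScard : S.card ≤ {x ∈ S | c x = b}.card * g :=
      Finset.card_le_mul_card_image S _ hmax
    obtain ⟨x₀, hx₀, hx₀b⟩ := Finset.mem_image.mp hb
    set S' := ({x ∈ S | c x = b}).image (fun x => x - x₀) with hS'
    have hS'card : S'.card = {x ∈ S | c x = b}.card :=
      Finset.card_image_of_injective _ fun x y h => sub_left_injective h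
    have hY : 0 ≤ Y := (hnonneg (Classical.arbitrary _) _).trans (hvY 0 (Classical.arbitrary _))
    obtain ⟨u, huΛ, hus, hudet, hucard⟩ := ih V B hB hpos Λ (4 * Y) (Fin.tail v) hvt
      (fun i => hvΛ _) (fun i σ => (hvY i.succ σ).trans (by linarith)) S' (by
        intro z hz
        obtain ⟨x, hx, rfl⟩ := Finset.mem_image.mp hz
        obtain ⟨hx, hxb⟩ := Finset.mem_filter.mp hx
        obtain ⟨hx1, hx2, hx3⟩ := hS x hx
        obtain ⟨hy1, hy2, hy3⟩ := hS x₀ hx₀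
        refine ⟨Λ.sub_mem hx1 hy1, ?_, fun σ => ?_⟩
        · have := W.sub_mem ((hspan x).mp hx2) ((hspan x₀).mp hy2)
          rw [hxb, hx₀b] at this
          rwa [show x - b • p - (x₀ - b • p) = x - x₀ by abel] at this
        · have e : B (x - x₀) (x - x₀) = 2 * B x x + 2 * B x₀ x₀ - B (x + x₀) (x + x₀) := by
            simp only [map_add, map_sub, LinearMap.add_apply, LinearMap.sub_apply]; ring
          rw [e]
          simp only [map_add, map_sub, map_mul, map_ofNat]
          have h1 := hx3 σ
          have h2 := hy3 σ
          have h3 := hnonneg σ (x + x₀)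
          simp only [map_add] at h3
          linarith)
    have hW' : Submodule.span F (Set.range u) = W := hus
    have hstspan : s - t - c (s - t) • p ∈ W :=
      (hspan _).mp (Submodule.sub_mem _ (hS s hsS).2.1 (hS t htS).2.1)
    have hcst0 : c (s - t) ≠ 0 := by rw [← hcst]; exact sub_ne_zero.mpr hst
    have hdet := det_bilinGram_cons hB u (w := s - t - c (s - t) • p) (p := p) (c (s - t))
      (by rw [hW']; exact hstspan) (fun i => hpW _ (hW' ▸ Submodule.subset_span ⟨i, rfl⟩))
    rw [sub_add_cancel] at hdet
    refine ⟨Fin.cons (s - t) u, ?_, ?_, ?_, ?_⟩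
    · intro i
      refine Fin.cases ?_ (fun i => ?_) i
      · exact Λ.sub_mem (hS s hsS).1 (hS t htS).1
      · simpa using huΛ i
    · ext x
      rw [hspan x, Fin.range_cons, Submodule.mem_span_insert, hW']
      constructor
      · rintro ⟨a, z, hz, rfl⟩
        have e : c (a • (s - t) + z) = a * c (s - t) := by
          simp only [hc, map_add, map_smul, smul_eq_mul, hpW z hz]; ring
        rw [e, show a • (s - t) + z - (a * c (s - t)) • p
          = a • (s - t - c (s - t) • p) + z by
            rw [smul_sub a (s - t), smul_smul]; abel]
        exact W.add_mem (W.smul_mem _ hstspan) hz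
      · intro h
        refine ⟨c x / c (s - t), (x - c x • p) - (c x / c (s - t)) • (s - t - c (s - t) • p),
          W.sub_mem h (W.smul_mem _ hstspan), ?_⟩
        rw [smul_sub _ (s - t), smul_smul, div_mul_cancel₀ _ hcst0]
        abel
    · rw [hdet]
      exact mul_ne_zero (mul_ne_zero (pow_ne_zero _ hcst0) hpp) hudet
    · rw [hdet, absN_mul, absN_mul, absN_sq]
      have hprod : (∏ σ : F →+* ℝ, √(Y / σ (B p p))) ^ 2 * absN (B p p) = Y ^ d := by
        rw [absN, ← Finset.prod_pow, ← Finset.prod_mul_distrib, hd, ← Finset.card_univ,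
          ← Finset.prod_const]
        refine Finset.prod_congr rfl fun σ _ => ?_
        have h3 := hpos σ p hp0
        rw [Real.sq_sqrt (div_nonneg hY h3.le), abs_of_pos h3, div_mul_cancel₀ _ h3.ne']
      have h1 : (g : ℝ) ^ 2 * absN (c (s - t)) ^ 2 * absN (B p p) ≤ 64 ^ d * Y ^ d := by
        have h2 : (absN (c (s - t)) * g) ^ 2 ≤ (8 ^ d * ∏ σ : F →+* ℝ, √(Y / σ (B p p))) ^ 2 :=
          pow_le_pow_left₀ (mul_nonneg (absN_nonneg _) (Nat.cast_nonneg _)) hNst 2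
        calc (g : ℝ) ^ 2 * absN (c (s - t)) ^ 2 * absN (B p p)
            = (absN (c (s - t)) * g) ^ 2 * absN (B p p) := by ring
          _ ≤ (8 ^ d * ∏ σ : F →+* ℝ, √(Y / σ (B p p))) ^ 2 * absN (B p p) :=
              mul_le_mul_of_nonneg_right h2 (absN_nonneg _)
          _ = (8 ^ d) ^ 2 * ((∏ σ : F →+* ℝ, √(Y / σ (B p p))) ^ 2 * absN (B p p)) := by ring
          _ = _ := by rw [hprod, ← pow_mul, mul_comm d, pow_mul]; norm_num
      have hSc : (S.card : ℝ) ≤ S'.card * g := by rw [hS'card]; exact_mod_cast hScard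
      refine (sq_mul_le_of_le_mul (Nat.cast_nonneg _) hSc (absN_nonneg _)
        (sq_nonneg _) (absN_nonneg _) h1 hucard (by positivity)).trans_eq ?_
      rw [mul_pow, mul_pow, pow_succ, mul_pow]; ring

end Count

/-! ### The level and Gram determinants -/

namespace QForm

variable {F : Type*} [Field F] [NumberField F] {n : ℕ}

omit [NumberField F] in
theorem toField_mulVec_coe (A : Matrix (Fin n) (Fin n) (𝓞 F)) (x : Fin n → 𝓞 F) :
    (toField A *ᵥ fun i => (x i : F)) = fun i => ((A *ᵥ x) i : F) := by
  ext i
  simp [toField, mulVec, dotProduct]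

omit [NumberField F] in
theorem coe_dotProduct (x y : Fin n → 𝓞 F) :
    (fun i => (x i : F)) ⬝ᵥ (fun i => (y i : F)) = ((x ⬝ᵥ y : 𝓞 F) : F) := by
  simp [dotProduct]

omit [NumberField F] in
theorem dotProduct_toField_mulVec_comm {A : Matrix (Fin n) (Fin n) (𝓞 F)} (hA : A.IsSymm)
    (y z : Fin n → F) : y ⬝ᵥ (toField A *ᵥ z) = (toField A *ᵥ y) ⬝ᵥ z := by
  have hs : (toField A)ᵀ = toField A := by rw [toField, ← Matrix.transpose_map, hA.eq]
  rw [dotProduct_mulVec, ← mulVec_transpose, hs]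

omit [NumberField F] in
theorem adjugate_mulVec_toField (A : Matrix (Fin n) (Fin n) (𝓞 F)) (y : Fin n → F) :
    toField A.adjugate *ᵥ (toField A *ᵥ y) = (A.det : F) • y := by
  have : toField A.adjugate * toField A = (A.det : F) • 1 := by
    rw [toField, toField, ← Matrix.map_mul, adjugate_mul]
    ext i j
    by_cases h : i = j <;> simp [h]
  rw [mulVec_mulVec, this, smul_mulVec, one_mulVec]

omit [NumberField F] in
theorem toField_mulVec_adjugate (A : Matrix (Fin n) (Fin n) (𝓞 F)) (y : Fin n → F) :
    toField A *ᵥ (toField A.adjugate *ᵥ y) = (A.det : F) • y := by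
  have : toField A * toField A.adjugate = (A.det : F) • 1 := by
    rw [toField, toField, ← Matrix.map_mul, mul_adjugate]
    ext i j
    by_cases h : i = j <;> simp [h]
  rw [mulVec_mulVec, this, smul_mulVec, one_mulVec]

omit [NumberField F] in
/-- The vectors `y` of the dual lattice are those with `A y` integral. -/
theorem exists_coe_eq_mulVec_of_mem_dualLattice {A : Matrix (Fin n) (Fin n) (𝓞 F)}
    (hA : A.IsSymm) {y : Fin n → F} (hy : y ∈ dualLattice A) :
    ∃ m : Fin n → 𝓞 F, toField A *ᵥ y = fun i => (m i : F) := by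
  choose f hf using hy
  refine ⟨fun i => f (Pi.single i 1), ?_⟩
  ext i
  change _ = algebraMap (𝓞 F) F _
  rw [hf, dotProduct_toField_mulVec_comm hA]
  have : (fun j => (((Pi.single i 1 : Fin n → 𝓞 F) j : 𝓞 F) : F)) = Pi.single i 1 := by
    ext j
    by_cases h : j = i
    · subst h; simp
    · simp [h]
  rw [this, dotProduct_single_one]

omit [NumberField F] in
theorem mem_level {A : Matrix (Fin n) (Fin n) (𝓞 F)} {a : 𝓞 F} :
    a ∈ level A ↔ ∀ y ∈ dualLattice A, ∃ t : 𝓞 F, (t : F) = a * eval A y := by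
  rw [level, Submodule.mem_comap, Submodule.mem_div_iff_forall_mul_mem]
  simp only [Algebra.linearMap_apply, Submodule.mem_one]
  constructor
  · intro h y hy
    exact h _ (Submodule.subset_span ⟨y, hy, rfl⟩)
  · intro h v hv
    refine Submodule.span_induction (p := fun v _ => ∃ t : 𝓞 F, algebraMap (𝓞 F) F t = a * v)
      ?_ ⟨0, by simp⟩ ?_ ?_ hv
    · rintro _ ⟨y, hy, rfl⟩
      exact h y hy
    · rintro x y - - ⟨s, hs⟩ ⟨t, ht⟩
      exact ⟨s + t, by rw [map_add, hs, ht, mul_add]⟩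
    · rintro c x - ⟨t, ht⟩
      refine ⟨c * t, ?_⟩
      rw [map_mul, ht, Algebra.smul_def]
      ring

theorem two_mul_det_mem_level {A : Matrix (Fin n) (Fin n) (𝓞 F)} (hA : A.IsSymm) :
    2 * A.det ∈ level A := by
  rw [mem_level]
  intro y hy
  obtain ⟨m, hm⟩ := exists_coe_eq_mulVec_of_mem_dualLattice hA hy
  refine ⟨(A.adjugate *ᵥ m) ⬝ᵥ m, ?_⟩
  rw [← coe_dotProduct, ← toField_mulVec_coe, ← hm, adjugate_mulVec_toField, eval,
    smul_dotProduct, smul_eq_mul]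
  have : (2 : F) ≠ 0 := two_ne_zero
  simp only [map_mul, map_ofNat]
  field_simp

/-- A diagonal entry of the adjugate of `Uᵀ A U` is `2 Δ Q(w)` for some `w` in the dual lattice,
so that its norm is at least `N(2Δ) / N(𝔫)`. -/
theorem absN_two_mul_normDet_le [IsTotallyReal F] {A : Matrix (Fin n) (Fin n) (𝓞 F)}
    (hA : A.IsSymm) (hdet : A.det ≠ 0) (U : Matrix (Fin n) (Fin n) (𝓞 F)) (i : Fin n)
    (hb : (Uᵀ * A * U).adjugate i i ≠ 0) :
    absN (2 : F) * normDet A ≤ absN ((Uᵀ * A * U).adjugate i i : F) * normLevel A := by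
  set b := (Uᵀ * A * U).adjugate i i with hbdef
  let m : Fin n → 𝓞 F := U.adjugate i
  have hbm : b = m ⬝ᵥ (A.adjugate *ᵥ m) := by
    rw [hbdef, adjugate_mul_distrib, adjugate_mul_distrib, ← adjugate_transpose, dotProduct_mulVec,
      ← Matrix.mul_assoc]
    simp only [m, Matrix.mul_apply, dotProduct, vecMul, Matrix.transpose_apply]
  have hΔ : (A.det : F) ≠ 0 := by simpa using hdet
  let w : Fin n → F := (A.det : F)⁻¹ • (toField A.adjugate *ᵥ fun j => (m j : F))
  have hAw : toField A *ᵥ w = fun j => (m j : F) := by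
    rw [mulVec_smul, toField_mulVec_adjugate, smul_smul, inv_mul_cancel₀ hΔ, one_smul]
  have hw : w ∈ dualLattice A := fun x => ⟨m ⬝ᵥ x, by
    rw [dotProduct_toField_mulVec_comm hA, hAw, coe_dotProduct]⟩
  have hev : eval A w = (b : F) / (2 * A.det) := by
    rw [eval, hAw, smul_dotProduct, toField_mulVec_coe, coe_dotProduct, dotProduct_comm, ← hbm,
      smul_eq_mul]
    field_simp
  have hle : Ideal.span {b} * level A ≤ Ideal.span {2 * A.det} := by
    rw [Ideal.span_singleton_mul_le_iff]
    intro a ha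
    obtain ⟨t, ht⟩ := mem_level.mp ha w hw
    rw [Ideal.mem_span_singleton]
    refine ⟨t, RingOfIntegers.ext ?_⟩
    rw [hev] at ht
    simp only [map_mul, map_ofNat, ht]
    field_simp
  have hlevel : level A ≠ ⊥ := fun h => by
    have := two_mul_det_mem_level hA
    rw [h, Ideal.mem_bot] at this
    exact mul_ne_zero two_ne_zero hdet this
  have hnorm := Ideal.absNorm_dvd_absNorm_of_le hle
  have h0 : Ideal.absNorm (Ideal.span {b} * level A) ≠ 0 := by
    rw [Ne, Ideal.absNorm_eq_zero_iff, ← Ideal.zero_eq_bot, mul_eq_zero, not_or, Ideal.zero_eq_bot,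
      Ideal.span_singleton_eq_bot]
    exact ⟨hb, hlevel⟩
  have h1 : (Ideal.absNorm (Ideal.span {2 * A.det}) : ℝ)
      ≤ Ideal.absNorm (Ideal.span {b} * level A) := by
    exact_mod_cast Nat.le_of_dvd (Nat.pos_of_ne_zero h0) hnorm
  rw [map_mul, Nat.cast_mul, ← absN_eq_absNorm, ← absN_eq_absNorm] at h1
  rw [normDet, ← absN_eq_absNorm, normLevel, ← absN_mul]
  simpa only [map_mul, map_ofNat] using h1

theorem normDet_eq [IsTotallyReal F] (A : Matrix (Fin n) (Fin n) (𝓞 F)) :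
    normDet A = absN (A.det : F) := by rw [normDet, absN_eq_absNorm]

theorem IsTotallyPosDef.det_ne_zero [IsTotallyReal F] {A : Matrix (Fin n) (Fin n) (𝓞 F)}
    (hA : IsTotallyPosDef A) : A.det ≠ 0 := by
  intro h
  have σ : F →+* ℝ := Classical.arbitrary _
  have h1 := (hA σ).det_pos
  rw [conj, toField, ← RingHom.mapMatrix_apply, ← RingHom.mapMatrix_apply, ← RingHom.map_det,
    ← RingHom.map_det, h, map_zero, map_zero] at h1
  exact lt_irrefl _ h1

theorem one_le_normDet [IsTotallyReal F] {A : Matrix (Fin n) (Fin n) (𝓞 F)} (h : A.det ≠ 0) :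
    1 ≤ normDet A := by
  rw [normDet_eq]; exact one_le_absN h

theorem one_le_absN_two [IsTotallyReal F] : 1 ≤ absN (2 : F) := by
  have := one_le_absN (F := F) (a := 2) two_ne_zero
  simpa only [map_ofNat] using this

theorem IsTotallyPosDef.eval_pos {A : Matrix (Fin n) (Fin n) (𝓞 F)}
    (hA : IsTotallyPosDef A) (σ : F →+* ℝ) {x : Fin n → F} (hx : x ≠ 0) : 0 < σ (eval A x) := by
  have h1 := conj_eval σ A x
  have h2 : (fun i => σ (x i)) ≠ 0 := fun h => hx (by
    ext i
    have := congr_fun h i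
    simpa using this)
  have h3 := (hA σ).dotProduct_mulVec_pos h2
  rw [star_trivial, h1] at h3
  linarith

/-- The bilinear form `xᵗ A y` on `F^n`; its value at `(x, x)` is `2 Q(x)`. -/
noncomputable def bilin (A : Matrix (Fin n) (Fin n) (𝓞 F)) : LinearMap.BilinForm F (Fin n → F) :=
  Matrix.toBilin' (toField A)

omit [NumberField F] in
theorem bilin_apply (A : Matrix (Fin n) (Fin n) (𝓞 F)) (x y : Fin n → F) :
    bilin A x y = x ⬝ᵥ (toField A *ᵥ y) := Matrix.toBilin'_apply' _ _ _

theorem bilin_self (A : Matrix (Fin n) (Fin n) (𝓞 F)) (x : Fin n → F) :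
    bilin A x x = 2 * eval A x := by
  rw [bilin_apply, eval]
  have : (2 : F) ≠ 0 := two_ne_zero
  field_simp

omit [NumberField F] in
theorem bilin_isSymm {A : Matrix (Fin n) (Fin n) (𝓞 F)} (hA : A.IsSymm) : (bilin A).IsSymm :=
  ⟨fun x y => by
    simp only [bilin_apply]
    rw [dotProduct_toField_mulVec_comm hA, dotProduct_comm]⟩

omit [NumberField F] in
/-- The Gram matrix of integral vectors, the columns of `Z`, is `Zᵀ A Z`. -/
theorem bilinGram_coe (A : Matrix (Fin n) (Fin n) (𝓞 F)) {k : ℕ}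
    (Z : Matrix (Fin n) (Fin k) (𝓞 F)) :
    (bilinGram (bilin A) fun j i => (Z i j : F)).det = ((Zᵀ * A * Z).det : F) := by
  refine Eq.trans ?_ (RingHom.map_det (algebraMap (𝓞 F) F) _).symm
  congr 1
  ext i j
  rw [bilinGram, Matrix.of_apply, bilin_apply, RingHom.mapMatrix_apply, Matrix.map_apply,
    Matrix.mul_assoc]
  exact (congr_arg _ (toField_mulVec_coe A fun a => Z a j)).trans (coe_dotProduct (fun a => Z a i) _)

/-- A nonzero Gram determinant of as many integral vectors as the dimension is `Δ` times the
square of a nonzero integer. -/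
theorem normDet_le_absN_det [IsTotallyReal F] (A U : Matrix (Fin n) (Fin n) (𝓞 F))
    (h : (Uᵀ * A * U).det ≠ 0) : normDet A ≤ absN ((Uᵀ * A * U).det : F) := by
  have e : (Uᵀ * A * U).det = U.det ^ 2 * A.det := by
    rw [det_mul, det_mul, det_transpose]; ring
  have hU : U.det ≠ 0 := by
    rintro h0
    rw [e, h0] at h
    simp at h
  rw [e]
  simp only [map_mul, map_pow]
  rw [absN_mul, absN_sq, normDet_eq]
  have h1 := one_le_absN hU
  exact le_mul_of_one_le_left (absN_nonneg _) (one_le_pow₀ h1)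

/-- A nonzero Gram determinant of one vector fewer than the dimension has norm at least
`N(Δ) / N(𝔫)`: it is the diagonal entry of an adjugate, as one sees by adding a zero vector. -/
theorem normDet_le_absN_det_mul_normLevel [IsTotallyReal F]
    {A : Matrix (Fin (n + 1)) (Fin (n + 1)) (𝓞 F)} (hA : A.IsSymm) (hdet : A.det ≠ 0)
    (Z : Matrix (Fin (n + 1)) (Fin n) (𝓞 F)) (h : (Zᵀ * A * Z).det ≠ 0) :
    normDet A ≤ absN ((Zᵀ * A * Z).det : F) * normLevel A := by
  let U : Matrix (Fin (n + 1)) (Fin (n + 1)) (𝓞 F) := Matrix.of fun i => Fin.cons 0 (Z i)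
  have hU : (Uᵀ * A * U).adjugate 0 0 = (Zᵀ * A * Z).det := by
    rw [adjugate_fin_succ_eq_det_submatrix]
    have : (Uᵀ * A * U).submatrix (Fin.succAbove 0) (Fin.succAbove 0) = Zᵀ * A * Z := by
      ext i j
      simp [U, Matrix.mul_apply]
    rw [this]
    simp
  have h1 := absN_two_mul_normDet_le hA hdet U 0 (by rwa [hU])
  rw [hU] at h1
  have h2 : 0 ≤ normDet A := Nat.cast_nonneg _
  have h3 := one_le_absN_two (F := F)
  nlinarith

variable [IsTotallyReal F]

theorem rpow_one_div_pow_card {y : ℝ} (hy : 0 ≤ y) :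
    (y ^ (1 / (Module.finrank ℚ F : ℝ))) ^ Fintype.card (F →+* ℝ) = y := by
  rw [card_realEmbeddings, one_div, Real.rpow_inv_natCast_pow hy]
  exact (Module.finrank_pos (R := ℚ) (M := F)).ne'

variable (F) in
/-- A box with many points contains `k` vectors spanning the same space as its points whose Gram
determinant has norm `≪ y^k / #²`. -/
theorem exists_gram_det_small (n : ℕ) : ∃ C : ℝ, 0 < C ∧
    ∀ A : Matrix (Fin n) (Fin n) (𝓞 F), A.IsSymm → IsTotallyPosDef A → ∀ y : ℝ, 0 ≤ y →
      ∀ S : Finset (Fin n → 𝓞 F), (∀ x ∈ S, ∀ σ : F →+* ℝ,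
        σ (eval A fun i => (x i : F)) ≤ y ^ (1 / (Module.finrank ℚ F : ℝ))) →
      ∃ k ≤ n, ∃ Z : Matrix (Fin n) (Fin k) (𝓞 F), (Zᵀ * A * Z).det ≠ 0 ∧
        (S.card : ℝ) ^ 2 * absN ((Zᵀ * A * Z).det : F) ≤ C * y ^ k := by
  classical
  choose C hC h using fun k => exists_card_sq_mul_absN_det_le F k
  refine ⟨∑ k ∈ Finset.range (n + 1), C k * (2 ^ k) ^ Fintype.card (F →+* ℝ),
    Finset.sum_pos (fun k _ => mul_pos (hC k) (by positivity)) (by simp),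
    fun A hA hpos y hy S hS => ?_⟩
  let ι : (Fin n → 𝓞 F) → (Fin n → F) := fun x i => (x i : F)
  have hι : Function.Injective ι := fun x y h => by
    ext i
    exact congr_fun h i
  obtain ⟨b, hbS, hbspan, hbli⟩ := exists_linearIndependent F (ι '' (S : Set (Fin n → 𝓞 F)))
  have hbfin : b.Finite := (S.finite_toSet.image ι).subset hbS
  have : Fintype b := hbfin.fintype
  set k := Fintype.card b with hk
  have hkn : k ≤ n := by
    simpa only [Module.finrank_fin_fun] using hbli.fintype_card_le_finrank
  let e : Fin k ≃ b := (Fintype.equivFin b).symm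
  let v : Fin k → Fin n → F := fun i => e i
  have hvrange : Set.range v = b := by
    ext x
    constructor
    · rintro ⟨i, rfl⟩; exact (e i).2
    · intro hx; exact ⟨e.symm ⟨x, hx⟩, by simp [v]⟩
  let Λ : AddSubgroup (Fin n → F) := (AddMonoidHom.compLeft
    ((algebraMap (𝓞 F) F : 𝓞 F →+* F) : 𝓞 F →+ F) (Fin n)).range
  have hΛ : ∀ x, ι x ∈ Λ := fun x => ⟨x, rfl⟩
  have hιS : ∀ x ∈ S, ∀ σ : F →+* ℝ,
      σ (bilin A (ι x) (ι x)) ≤ 2 * y ^ (1 / (Module.finrank ℚ F : ℝ)) := fun x hx σ => by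
    rw [bilin_self, map_mul, map_ofNat]
    exact mul_le_mul_of_nonneg_left (hS x hx σ) zero_le_two
  have hv : ∀ i, ∃ x ∈ S, ι x = v i := fun i => hbS (e i).2
  obtain ⟨u, huΛ, -, hu0, hu⟩ := h k (Fin n → F) (bilin A) (bilin_isSymm hA)
    (fun σ x hx => by
      rw [bilin_self, map_mul, map_ofNat]
      have := hpos.eval_pos σ hx
      positivity) Λ
    (2 * y ^ (1 / (Module.finrank ℚ F : ℝ))) v (hbli.comp e e.injective)
    (fun i => by obtain ⟨x, -, hx⟩ := hv i; rw [← hx]; exact hΛ x)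
    (fun i => by obtain ⟨x, hxS, hx⟩ := hv i; rw [← hx]; exact hιS x hxS) (S.image ι) (by
      intro z hz
      obtain ⟨x, hx, rfl⟩ := Finset.mem_image.mp hz
      refine ⟨hΛ x, ?_, hιS x hx⟩
      rw [hvrange, hbspan]
      exact Submodule.subset_span ⟨x, hx, rfl⟩)
  choose z hz using huΛ
  have hzu : u = fun j i => ((Matrix.of fun i j => z j i : Matrix (Fin n) (Fin k) (𝓞 F)) i j : F) :=
    by
    ext j i
    rw [← hz j]
    rfl
  rw [hzu, bilinGram_coe] at hu0 hu
  refine ⟨k, hkn, Matrix.of fun i j => z j i, fun h0 => hu0 (by simp [h0]), ?_⟩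
  rw [Finset.card_image_of_injective _ hι] at hu
  refine hu.trans ?_
  rw [mul_pow, mul_pow, ← pow_mul _ k, mul_comm k, pow_mul _ _ k, pow_right_comm _ k,
    rpow_one_div_pow_card hy, ← mul_assoc, pow_right_comm _ _ k]
  refine mul_le_mul_of_nonneg_right ?_ (by positivity)
  exact Finset.single_le_sum (f := fun k => C k * (2 ^ k) ^ Fintype.card (F →+* ℝ))
    (fun k _ => (mul_pos (hC k) (by positivity)).le) (Finset.mem_range.mpr (by omega))

omit [NumberField F] [IsTotallyReal F] in
theorem eq_of_mem_reps {A : Matrix (Fin n) (Fin n) (𝓞 F)} {ℓ ℓ' : 𝓞 F} {x : Fin n → 𝓞 F}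
    (h : x ∈ reps A ℓ) (h' : x ∈ reps A ℓ') : ℓ = ℓ' :=
  RingOfIntegers.ext (h.symm.trans h')

theorem le_sqrt_mul_of_sq_mul_le {s g G C q t : ℝ} (hs : 0 ≤ s) (hG : 0 < G) (hg : G ≤ g)
    (hC : 0 ≤ C) (ht : 0 ≤ t) (h : s ^ 2 * g ≤ C * q) (hq : q ≤ t ^ 2 * G) : s ≤ √C * t := by
  have h1 : s ^ 2 * G ≤ C * t ^ 2 * G := by nlinarith [sq_nonneg s]
  have h2 : s ^ 2 ≤ C * t ^ 2 := le_of_mul_le_mul_right h1 hG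
  rw [← pow_le_pow_iff_left₀ hs (by positivity) two_ne_zero, mul_pow, Real.sq_sqrt hC]
  exact h2

theorem sq_rpow_half {x : ℝ} (hx : 0 ≤ x) : (x ^ (1 / 2 : ℝ)) ^ 2 = x := by
  rw [← Real.sqrt_eq_rpow, Real.sq_sqrt hx]

theorem sq_rpow_three_halves {x : ℝ} (hx : 0 ≤ x) : (x ^ (3 / 2 : ℝ)) ^ 2 = x ^ 3 := by
  rw [← Real.rpow_natCast (x ^ (3 / 2 : ℝ)), ← Real.rpow_mul hx, ← Real.rpow_natCast x 3]
  norm_num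

variable (F) in
/-- The bound for the number of vectors in the box. The rank of the span of the box decides which
of the three terms dominates: at most two, three or four. -/
theorem sum_r_le : ∃ C : ℝ, 0 < C ∧
    ∀ A : Matrix (Fin 4) (Fin 4) (𝓞 F), IsIntegralForm A → IsTotallyPosDef A →
      ∀ y : ℝ, 1 < y → ∑ ℓ ∈ box F y, (r A ℓ : ℝ) ≤
        C * (y ^ 2 / normDet A ^ (1 / 2 : ℝ)
          + y ^ (3 / 2 : ℝ) / (normDet A / normLevel A) ^ (1 / 2 : ℝ) + y) := by
  classical
  obtain ⟨C, hC, h⟩ := exists_gram_det_small F 4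
  refine ⟨√C, Real.sqrt_pos.mpr hC, fun A hA hpos y hy => ?_⟩
  have hy0 : 0 < y := by linarith
  have hdet := hpos.det_ne_zero
  have hΔ := one_le_normDet hdet
  set S : Finset (Fin 4 → 𝓞 F) := (box F y).biUnion fun ℓ => (reps_finite hpos ℓ).toFinset with hS
  have hcard : ∑ ℓ ∈ box F y, (r A ℓ : ℝ) = S.card := by
    rw [hS, Finset.card_biUnion, Nat.cast_sum]
    · refine Finset.sum_congr rfl fun ℓ _ => ?_
      rw [r, Set.ncard_eq_toFinset_card _ (reps_finite hpos ℓ)]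
    · intro ℓ _ ℓ' _ hne
      refine Finset.disjoint_left.mpr ?_
      intro x hx hx'
      exact hne (eq_of_mem_reps ((Set.Finite.mem_toFinset _).mp hx)
        ((Set.Finite.mem_toFinset _).mp hx'))
  rw [hcard]
  obtain ⟨k, hk, Z, hZ0, hZ⟩ := h A hA.symm hpos y hy0.le S (by
    intro x hx σ
    obtain ⟨ℓ, hℓ, hx⟩ := Finset.mem_biUnion.mp hx
    rw [Set.Finite.mem_toFinset] at hx
    rw [show eval A (fun i => (x i : F)) = (ℓ : F) from hx]
    exact (((boxSet_finite (F := F) y).mem_toFinset.mp hℓ) σ).2)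
  have hs : (0 : ℝ) ≤ S.card := Nat.cast_nonneg _
  have h1 : 0 ≤ y ^ 2 / normDet A ^ (1 / 2 : ℝ) := by positivity
  have hN : 0 ≤ normLevel A := Nat.cast_nonneg _
  have h2 : 0 ≤ y ^ (3 / 2 : ℝ) / (normDet A / normLevel A) ^ (1 / 2 : ℝ) := by positivity
  suffices h' : ∃ t, 0 ≤ t ∧ (t = y ^ 2 / normDet A ^ (1 / 2 : ℝ) ∨
      t = y ^ (3 / 2 : ℝ) / (normDet A / normLevel A) ^ (1 / 2 : ℝ) ∨ t = y) ∧ S.card ≤ √C * t by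
    obtain ⟨t, ht0, ht, hle⟩ := h'
    refine hle.trans (mul_le_mul_of_nonneg_left ?_ (Real.sqrt_nonneg _))
    rcases ht with rfl | rfl | rfl <;> linarith
  have hg1 := one_le_absN hZ0
  rcases (by omega : k ≤ 2 ∨ k = 3 ∨ k = 4) with hk2 | rfl | rfl
  · refine ⟨y, hy0.le, by simp, le_sqrt_mul_of_sq_mul_le hs one_pos hg1 hC.le hy0.le hZ ?_⟩
    rw [mul_one]
    exact pow_le_pow_right₀ hy.le hk2
  · refine ⟨_, h2, by simp, ?_⟩
    have h3 := normDet_le_absN_det_mul_normLevel hA.symm hdet Z hZ0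
    have hN' : 0 < normLevel A := by
      rcases hN.eq_or_lt with h0 | h0
      · rw [← h0, mul_zero] at h3; linarith
      · exact h0
    refine le_sqrt_mul_of_sq_mul_le hs (G := normDet A / normLevel A) (by positivity)
      (by rwa [div_le_iff₀ hN']) hC.le h2 hZ ?_
    rw [div_pow, sq_rpow_half (by positivity), sq_rpow_three_halves hy0.le,
      div_mul_cancel₀ _ (by positivity)]
  · refine ⟨_, h1, by simp, ?_⟩
    refine le_sqrt_mul_of_sq_mul_le hs (G := normDet A) (by positivity)
      (normDet_le_absN_det A Z hZ0) hC.le h1 hZ ?_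
    rw [div_pow, sq_rpow_half (by positivity), div_mul_cancel₀ _ (by positivity), ← pow_mul]

end QForm

/-! ### Divisors of bounded size in number fields -/

namespace NumberField

universe u

theorem two_le_absNorm_of_prime {E : Type u} [Field E] [NumberField E] {P : Ideal (𝓞 E)}
    (hP : Prime P) : 2 ≤ Ideal.absNorm P := by
  have h0 : Ideal.absNorm P ≠ 0 := by
    rw [Ne, Ideal.absNorm_eq_zero_iff]; exact hP.ne_zero
  have h1 : Ideal.absNorm P ≠ 1 := by
    rw [Ne, Ideal.absNorm_eq_one_iff, ← Ideal.one_eq_top, ← Ideal.isUnit_iff.trans Ideal.one_eq_top.symm.congr_right]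
    exact hP.not_isUnit
  omega

theorem absNorm_span_natCast {E : Type u} [Field E] [NumberField E] (m : ℕ) :
    Ideal.absNorm (Ideal.span {(m : 𝓞 E)}) = m ^ Module.finrank ℚ E := by
  have h := absNorm_span_eq_prod (m : 𝓞 E)
  simp only [map_natCast, Complex.norm_natCast, Finset.prod_const, Finset.card_univ,
    Embeddings.card] at h
  exact_mod_cast h

/-- The number of prime ideals of norm at most `B` is bounded in terms of `B` and the degree. -/
theorem card_primes_le {E : Type u} [Field E] [NumberField E] (B D : ℕ)
    (hD : Module.finrank ℚ E ≤ D) (s : Finset (Ideal (𝓞 E))) (hs : ∀ P ∈ s, Prime P)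
    (hB : ∀ P ∈ s, Ideal.absNorm P ≤ B) : s.card ≤ B.factorial ^ D := by
  have hdvd : ∏ P ∈ s, P ∣ Ideal.span {(B.factorial : 𝓞 E)} := by
    refine Finset.prod_primes_dvd _ hs fun P hP => ?_
    rw [Ideal.dvd_span_singleton]
    obtain ⟨c, hc⟩ := Nat.dvd_factorial
      (by linarith [two_le_absNorm_of_prime (hs P hP)]) (hB P hP)
    rw [hc, Nat.cast_mul]
    exact Ideal.mul_mem_right _ _ (Ideal.absNorm_mem P)
  have h1 : ∏ P ∈ s, Ideal.absNorm P ∣ B.factorial ^ Module.finrank ℚ E := by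
    rw [← absNorm_span_natCast, ← map_prod]
    exact map_dvd Ideal.absNorm hdvd
  have h2 := Nat.le_of_dvd (by positivity) h1
  calc s.card ≤ 2 ^ s.card := Nat.lt_two_pow_self.le
    _ = ∏ P ∈ s, 2 := by simp
    _ ≤ ∏ P ∈ s, Ideal.absNorm P :=
        Finset.prod_le_prod' fun P hP => two_le_absNorm_of_prime (hs P hP)
    _ ≤ _ := h2
    _ ≤ _ := Nat.pow_le_pow_right (Nat.factorial_pos _) hD

theorem succ_le_mul_pow {δ x : ℝ} (hδ : 0 < δ) (hx : 1 + δ ≤ x) (e : ℕ) :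
    (e : ℝ) + 1 ≤ (1 + δ⁻¹) * x ^ e := by
  have h1 : 1 + e * δ ≤ x ^ e :=
    (one_add_mul_le_pow (by linarith) e).trans (pow_le_pow_left₀ (by linarith) hx e)
  have h2 : (1 + δ⁻¹) * (1 + e * δ) = e + 1 + δ⁻¹ + e * δ := by field_simp; ring
  have h3 : (1 + δ⁻¹) * (1 + e * δ) ≤ (1 + δ⁻¹) * x ^ e := by gcongr
  have : 0 < δ⁻¹ := by positivity
  have : 0 ≤ e * δ := by positivity
  linarith

open UniqueFactorizationMonoid in
/-- The divisor bound for ideals, uniform in number fields of bounded degree. -/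
theorem exists_card_ideal_divisors_le (D : ℕ) {ε : ℝ} (hε : 0 < ε) : ∃ C : ℝ, 1 ≤ C ∧
    ∀ (E : Type u) [Field E] [NumberField E], Module.finrank ℚ E ≤ D →
      ∀ J : Ideal (𝓞 E), J ≠ ⊥ → ∀ T : Finset (Ideal (𝓞 E)), (∀ I ∈ T, I ∣ J) →
        (T.card : ℝ) ≤ C * (Ideal.absNorm J : ℝ) ^ ε := by
  classical
  set δ : ℝ := 2 ^ ε - 1 with hδdef
  have hδ : 0 < δ := by
    have := Real.one_lt_rpow (one_lt_two) hε
    rw [hδdef]; linarith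
  obtain ⟨B, hB⟩ := exists_nat_ge ((2 : ℝ) ^ ε⁻¹)
  set c : ℝ := 1 + δ⁻¹ with hc
  have hc1 : 1 ≤ c := by rw [hc]; have : 0 < δ⁻¹ := by positivity
                         linarith
  refine ⟨c ^ (B.factorial ^ D), one_le_pow₀ hc1, fun E _ _ hD J hJ T hT => ?_⟩
  set s := normalizedFactors J with hs
  have hsp : ∀ P ∈ s.toFinset, Prime P := fun P hP =>
    prime_of_normalized_factor P (Multiset.mem_toFinset.mp hP)
  have hcard : T.card ≤ ∏ P ∈ s.toFinset, (s.count P + 1) := by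
    rw [← Multiset.card_Iic]
    have hT0 : ∀ I ∈ T, I ≠ 0 := fun I hI => ne_zero_of_dvd_ne_zero hJ (hT I hI)
    refine Finset.card_le_card_of_injOn normalizedFactors (fun I hI => ?_) fun I hI I' hI' h => ?_
    · rw [Finset.mem_coe, Finset.mem_Iic]
      exact (dvd_iff_normalizedFactors_le_normalizedFactors (hT0 I hI) hJ).mp (hT I hI)
    · rw [← Ideal.prod_normalizedFactors_eq_self (hT0 I hI),
        ← Ideal.prod_normalizedFactors_eq_self (hT0 I' hI'), h]
  have hnorm : (Ideal.absNorm J : ℝ) ^ ε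
      = ∏ P ∈ s.toFinset, ((Ideal.absNorm P : ℝ) ^ ε) ^ s.count P := by
    conv_lhs => rw [← Ideal.prod_normalizedFactors_eq_self hJ]
    rw [Finset.prod_multiset_count, map_prod, Nat.cast_prod, ← Real.finsetProd_rpow _ _
      (fun _ _ => Nat.cast_nonneg _)]
    refine Finset.prod_congr rfl fun P _ => ?_
    rw [map_pow, Nat.cast_pow, ← Real.rpow_natCast, ← Real.rpow_natCast, ← Real.rpow_mul
      (Nat.cast_nonneg _), ← Real.rpow_mul (Nat.cast_nonneg _), mul_comm]
  have hfac : ∀ P ∈ s.toFinset, ((s.count P : ℝ) + 1)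
      ≤ (if Ideal.absNorm P ≤ B then c else 1) * ((Ideal.absNorm P : ℝ) ^ ε) ^ s.count P := by
    intro P hP
    have h2 : (2 : ℝ) ≤ Ideal.absNorm P := by exact_mod_cast two_le_absNorm_of_prime (hsp P hP)
    split_ifs with h
    · refine succ_le_mul_pow hδ ?_ _
      have := Real.rpow_le_rpow zero_le_two h2 hε.le
      rw [hδdef]; linarith
    · have h3 : (2 : ℝ) ^ ε⁻¹ ≤ Ideal.absNorm P := by
        refine hB.trans ?_
        exact_mod_cast (not_le.mp h).le
      have h4 := Real.rpow_le_rpow (by positivity) h3 hε.le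
      rw [← Real.rpow_mul zero_le_two, inv_mul_cancel₀ hε.ne', Real.rpow_one] at h4
      rw [one_mul]
      have h5 := one_add_mul_le_pow (a := (1 : ℝ)) (by norm_num) (s.count P)
      calc (s.count P : ℝ) + 1 ≤ (1 + 1) ^ s.count P := by linarith
        _ ≤ _ := pow_le_pow_left₀ (by norm_num) (by linarith) _
  calc (T.card : ℝ) ≤ ∏ P ∈ s.toFinset, ((s.count P : ℝ) + 1) := by exact_mod_cast hcard
    _ ≤ ∏ P ∈ s.toFinset, ((if Ideal.absNorm P ≤ B then c else 1)
        * ((Ideal.absNorm P : ℝ) ^ ε) ^ s.count P) :=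
        Finset.prod_le_prod (fun _ _ => by positivity) hfac
    _ = c ^ (s.toFinset.filter fun P => Ideal.absNorm P ≤ B).card * (Ideal.absNorm J : ℝ) ^ ε := by
        rw [Finset.prod_mul_distrib, hnorm, Finset.prod_ite, Finset.prod_const, Finset.prod_const,
          one_pow, mul_one]
    _ ≤ _ := by
        refine mul_le_mul_of_nonneg_right (pow_le_pow_right₀ hc1 ?_) (by positivity)
        exact card_primes_le B D hD _ (fun P hP => hsp P (Finset.mem_filter.mp hP).1)
          fun P hP => (Finset.mem_filter.mp hP).2

theorem abs_sub_lt_of_floor_logb_eq {x y : ℝ} (hx : 0 < x) (hy : 0 < y)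
    (h : ⌊Real.logb 2 x⌋ = ⌊Real.logb 2 y⌋) : x < 2 * y := by
  have h1 := Int.abs_sub_lt_one_of_floor_eq_floor h
  have h2 : Real.logb 2 x < Real.logb 2 (2 * y) := by
    rw [Real.logb_mul two_ne_zero hy.ne', Real.logb_self_eq_one one_lt_two]
    linarith [(abs_lt.mp h1).2]
  exact (Real.logb_lt_logb_iff one_lt_two hx (by positivity)).mp h2

/-- Elements that generate the same ideal and have the same size, up to a factor `2`, under all
embeddings differ by units in a bounded region; such units are distinct modulo `5`. -/
theorem card_le_of_associated {E : Type u} [Field E] [NumberField E] (T : Finset (𝓞 E))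
    (h0 : ∀ α ∈ T, α ≠ 0) (hspan : ∀ α ∈ T, ∀ β ∈ T, Ideal.span {α} = Ideal.span {β})
    (hlog : ∀ α ∈ T, ∀ β ∈ T, ∀ φ : E →+* ℂ, ⌊Real.logb 2 ‖φ α‖⌋ = ⌊Real.logb 2 ‖φ β‖⌋) :
    T.card ≤ 5 ^ Module.finrank ℚ E := by
  classical
  rcases T.eq_empty_or_nonempty with rfl | ⟨β, hβ⟩
  · simp
  have hdvd : ∀ α ∈ T, ∃ η : 𝓞 E, α = β * η := fun α hα => by
    have := Ideal.span_singleton_le_span_singleton.mp (hspan α hα β hβ).le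
    exact this
  choose! η hη using hdvd
  have hη2 : ∀ α ∈ T, ∀ φ : E →+* ℂ, ‖φ (η α)‖ < 2 := by
    intro α hα φ
    have hβ0 : 0 < ‖φ β‖ := by simpa using h0 β hβ
    have hα0 : 0 < ‖φ α‖ := by simpa using h0 α hα
    have h1 := abs_sub_lt_of_floor_logb_eq hα0 hβ0 (hlog α hα β hβ φ)
    have h2 : ‖φ α‖ = ‖φ β‖ * ‖φ (η α)‖ := by
      conv_lhs => rw [hη α hα]
      simp only [map_mul, norm_mul]
    rw [h2, mul_comm] at h1
    exact lt_of_mul_lt_mul_right h1 hβ0.le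
  have hcard := absNorm_span_natCast (E := E) 5
  rw [Ideal.absNorm_apply, Submodule.cardQuot_apply] at hcard
  have hfin : Finite (𝓞 E ⧸ Ideal.span {((5 : ℕ) : 𝓞 E)}) :=
    Nat.finite_of_card_ne_zero (by rw [hcard]; positivity)
  have : Fintype (𝓞 E ⧸ Ideal.span {((5 : ℕ) : 𝓞 E)}) := Fintype.ofFinite _
  rw [← hcard, Nat.card_eq_fintype_card, ← Finset.card_univ]
  refine Finset.card_le_card_of_injOn
    (fun α => Ideal.Quotient.mk (Ideal.span {((5 : ℕ) : 𝓞 E)}) (η α))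
    (fun _ _ => Finset.mem_coe.mpr (Finset.mem_univ _)) fun α hα α' hα' h => ?_
  obtain ⟨γ, hγ⟩ := Ideal.mem_span_singleton.mp (Ideal.Quotient.eq.mp h)
  have hγ0 : γ = 0 := by
    refine eq_zero_of_norm_lt_one fun φ => ?_
    have h1 : ‖φ (η α - η α')‖ = 5 * ‖φ γ‖ := by
      have : ((η α : E) - η α') = 5 * γ := by
        have := congr_arg (algebraMap (𝓞 E) E) hγ
        simpa only [map_sub, map_mul, Nat.cast_ofNat, map_ofNat] using this
      rw [this, map_mul, norm_mul, map_ofNat, Complex.norm_ofNat]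
    have h2 : ‖φ (η α - η α')‖ ≤ ‖φ (η α)‖ + ‖φ (η α')‖ := by
      rw [map_sub]; exact norm_sub_le _ _
    have h3 := hη2 α hα φ
    have h4 := hη2 α' hα' φ
    linarith
  rw [hη α hα, hη α' hα', sub_eq_zero.mp (hγ.trans (by rw [hγ0, mul_zero]))]

/-- A power of a logarithm is dominated by any power. -/
theorem exists_mul_logb_add_pow_le (a b : ℝ) (ha : 0 ≤ a) (hb : 0 ≤ b) (D : ℕ) {ε : ℝ}
    (hε : 0 < ε) : ∃ C : ℝ, 0 < C ∧ ∀ P : ℝ, 1 ≤ P → (a * Real.logb 2 P + b) ^ D ≤ C * P ^ ε := by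
  set ε' : ℝ := ε / (D + 1) with hε'
  have hε'0 : 0 < ε' := by positivity
  set c : ℝ := a / (ε' * Real.log 2) + b + 1 with hc
  have hlog2 : 0 < Real.log 2 := Real.log_pos one_lt_two
  have hc1 : 0 < c := by positivity
  refine ⟨c ^ D, by positivity, fun P hP => ?_⟩
  have h1 : Real.log P ≤ P ^ ε' / ε' := Real.log_le_rpow_div (by linarith) hε'0
  have h2 : 1 ≤ P ^ ε' := Real.one_le_rpow hP hε'0.le
  have h3 : a * Real.logb 2 P + b ≤ c * P ^ ε' := by
    have : a * Real.logb 2 P ≤ a / (ε' * Real.log 2) * P ^ ε' := by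
      rw [Real.logb, div_mul_eq_mul_div, mul_div_assoc']
      rw [div_le_div_iff₀ hlog2 (by positivity)]
      have := mul_le_mul_of_nonneg_left h1 ha
      have e : a * (P ^ ε' / ε') * (ε' * Real.log 2) = a * P ^ ε' * Real.log 2 := by field_simp
      rw [← e]
      gcongr
    rw [hc]
    nlinarith
  have h4 : 0 ≤ a * Real.logb 2 P + b :=
    add_nonneg (mul_nonneg ha (Real.logb_nonneg one_lt_two hP)) hb
  calc (a * Real.logb 2 P + b) ^ D ≤ (c * P ^ ε') ^ D := pow_le_pow_left₀ h4 h3 D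
    _ = c ^ D * P ^ (ε' * D) := by
        rw [mul_pow, Real.rpow_mul (by linarith), Real.rpow_natCast]
    _ ≤ c ^ D * P ^ ε := by
        refine mul_le_mul_of_nonneg_left (Real.rpow_le_rpow_of_exponent_le hP ?_) (by positivity)
        rw [hε', div_mul_eq_mul_div, div_le_iff₀ (by positivity)]
        nlinarith

/-- The divisors `α` of an integer `m` such that all conjugates of `α` and `m` are at most `P` are
`≪ P^ε` in number, uniformly in number fields of bounded degree. -/
theorem exists_card_divisors_le (D : ℕ) {ε : ℝ} (hε : 0 < ε) : ∃ C : ℝ, 0 < C ∧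
    ∀ (E : Type u) [Field E] [NumberField E], Module.finrank ℚ E ≤ D →
      ∀ P : ℝ, 1 ≤ P → ∀ m : 𝓞 E, m ≠ 0 → (∀ φ : E →+* ℂ, ‖φ m‖ ≤ P) →
        ∀ T : Finset (𝓞 E), (∀ α ∈ T, α ∣ m ∧ ∀ φ : E →+* ℂ, ‖φ α‖ ≤ P) →
          (T.card : ℝ) ≤ C * P ^ ε := by
  classical
  set ε' : ℝ := ε / (2 * (D + 1)) with hε'
  have hε'0 : 0 < ε' := by positivity
  obtain ⟨C₁, hC₁, h₁⟩ := exists_card_ideal_divisors_le.{u} D hε'0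
  obtain ⟨C₂, hC₂, h₂⟩ := exists_mul_logb_add_pow_le (2 * D) 2 (by positivity) (by positivity) D
    (ε := ε / 2) (by positivity)
  refine ⟨5 ^ D * (C₁ * C₂), by positivity, fun E _ _ hD P hP m hm hmP T hT => ?_⟩
  have hP0 : 0 < P := by linarith
  set e := Module.finrank ℚ E with he
  have hcard : Fintype.card (E →+* ℂ) = e := Embeddings.card E ℂ
  have hT0 : ∀ α ∈ T, α ≠ 0 := fun α hα => ne_zero_of_dvd_ne_zero hm (hT α hα).1
  set L := Real.logb 2 P with hL
  have hL0 : 0 ≤ L := Real.logb_nonneg one_lt_two hP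
  have hlog : ∀ α ∈ T, ∀ φ : E →+* ℂ, |Real.logb 2 ‖φ α‖| ≤ D * L := by
    intro α hα φ
    have hα0 : 0 < ‖φ α‖ := by simpa using hT0 α hα
    have hD1 : (1 : ℝ) ≤ D := by
      have : 1 ≤ e := Module.finrank_pos
      exact_mod_cast this.trans hD
    rw [abs_le]
    constructor
    · have h3 : 1 ≤ ‖φ α‖ * P ^ D := by
        refine (one_le_prod_norm (hT0 α hα)).trans ?_
        rw [← Finset.mul_prod_erase _ _ (Finset.mem_univ φ)]
        refine mul_le_mul_of_nonneg_left ?_ hα0.le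
        calc ∏ ψ ∈ Finset.univ.erase φ, ‖ψ α‖ ≤ ∏ ψ ∈ Finset.univ.erase φ, P :=
              Finset.prod_le_prod (fun _ _ => norm_nonneg _) fun ψ _ => (hT α hα).2 ψ
          _ ≤ P ^ D := by
              rw [Finset.prod_const]
              refine pow_le_pow_right₀ hP ((Finset.card_le_univ _).trans ?_)
              rw [hcard]; exact hD
      have h4 := Real.logb_nonneg one_lt_two h3
      rw [Real.logb_mul hα0.ne' (by positivity), Real.logb_pow] at h4
      linarith
    · have h3 := Real.logb_le_logb_of_le one_lt_two hα0 ((hT α hα).2 φ)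
      nlinarith
  let f : 𝓞 E → Ideal (𝓞 E) × ((E →+* ℂ) → ℤ) :=
    fun α => (Ideal.span {α}, fun φ => ⌊Real.logb 2 ‖φ α‖⌋)
  have hfib : T.card ≤ 5 ^ e * (T.image f).card := by
    refine Finset.card_le_mul_card_image T _ fun b _ => ?_
    refine card_le_of_associated _ (fun α hα => hT0 α (Finset.mem_filter.mp hα).1) ?_ ?_
    · intro α hα β hβ
      have := (Finset.mem_filter.mp hα).2.trans (Finset.mem_filter.mp hβ).2.symm
      exact (Prod.ext_iff.mp this).1
    · intro α hα β hβ φ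
      have := (Finset.mem_filter.mp hα).2.trans (Finset.mem_filter.mp hβ).2.symm
      exact congr_fun (Prod.ext_iff.mp this).2 φ
  set M : ℤ := ⌊D * L⌋ with hM
  have hM0 : 0 ≤ M := Int.floor_nonneg.mpr (by positivity)
  have himg : T.image f ⊆ (T.image fun α => Ideal.span {α}) ×ˢ
      Fintype.piFinset fun _ : E →+* ℂ => Finset.Icc (-(M + 1)) M := by
    intro b hb
    obtain ⟨α, hα, rfl⟩ := Finset.mem_image.mp hb
    rw [Finset.mem_product]
    refine ⟨Finset.mem_image_of_mem _ hα, Fintype.mem_piFinset.mpr fun φ => ?_⟩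
    have h3 := abs_le.mp (hlog α hα φ)
    rw [Finset.mem_Icc]
    refine ⟨?_, Int.floor_le_floor h3.2⟩
    rw [Int.le_floor]
    push_cast
    linarith [Int.lt_floor_add_one (D * L)]
  have hcardimg : ((T.image f).card : ℝ)
      ≤ (T.image fun α => Ideal.span {α}).card * (2 * D * L + 2) ^ D := by
    have h3 := Finset.card_le_card himg
    rw [Finset.card_product, Fintype.card_piFinset, Finset.prod_const, Finset.card_univ, Int.card_Icc, hcard] at h3
    have h4 : (((M + 1 - -(M + 1)).toNat : ℕ) : ℝ) ≤ 2 * D * L + 2 := by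
      have : (((M + 1 - -(M + 1)).toNat : ℕ) : ℤ) = 2 * M + 2 := by omega
      have h5 : (((M + 1 - -(M + 1)).toNat : ℕ) : ℝ) = 2 * M + 2 := by exact_mod_cast this
      rw [h5]
      linarith [Int.floor_le (D * L)]
    have h6 : (1 : ℝ) ≤ 2 * D * L + 2 := by
      have : 0 ≤ 2 * D * L := by positivity
      linarith
    calc ((T.image f).card : ℝ)
        ≤ (T.image fun α => Ideal.span {α}).card * ((M + 1 - -(M + 1)).toNat : ℝ) ^ e := by
          exact_mod_cast h3
      _ ≤ (T.image fun α => Ideal.span {α}).card * (2 * D * L + 2) ^ e := by gcongr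
      _ ≤ _ := by gcongr
  have hideals : ((T.image fun α => Ideal.span {α}).card : ℝ) ≤ C₁ * P ^ (ε / 2) := by
    refine (h₁ E hD (Ideal.span {m}) (by simpa using hm) _ fun I hI => ?_).trans ?_
    · obtain ⟨α, hα, rfl⟩ := Finset.mem_image.mp hI
      rw [Ideal.dvd_span_singleton, Ideal.mem_span_singleton]
      exact (hT α hα).1
    · refine mul_le_mul_of_nonneg_left ?_ (by linarith)
      have h3 : (Ideal.absNorm (Ideal.span {m}) : ℝ) ≤ P ^ D := by
        rw [absNorm_span_eq_prod]
        calc ∏ φ : E →+* ℂ, ‖φ m‖ ≤ ∏ φ : E →+* ℂ, P :=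
              Finset.prod_le_prod (fun _ _ => norm_nonneg _) fun φ _ => hmP φ
          _ ≤ P ^ D := by
              rw [Finset.prod_const, Finset.card_univ, hcard]
              exact pow_le_pow_right₀ hP hD
      refine (Real.rpow_le_rpow (Nat.cast_nonneg _) h3 hε'0.le).trans ?_
      rw [← Real.rpow_natCast, ← Real.rpow_mul hP0.le]
      refine Real.rpow_le_rpow_of_exponent_le hP ?_
      rw [hε', mul_div_assoc', div_le_div_iff₀ (by positivity) two_pos]
      nlinarith
  calc (T.card : ℝ) ≤ 5 ^ e * (T.image f).card := by exact_mod_cast hfib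
    _ ≤ 5 ^ D * ((C₁ * P ^ (ε / 2)) * (C₂ * P ^ (ε / 2))) := by
        refine mul_le_mul (pow_le_pow_right₀ (by norm_num) hD) ?_ (by positivity) (by positivity)
        exact hcardimg.trans (mul_le_mul hideals (h₂ P hP) (by positivity) (by positivity))
    _ = 5 ^ D * (C₁ * C₂) * P ^ ε := by
        rw [show ε = ε / 2 + ε / 2 by ring, Real.rpow_add hP0]
        ring_nf

end NumberField

/-! ### Binary norm equations -/

namespace NumberField

universe u

variable {F : Type u} [Field F] [NumberField F] [IsTotallyReal F]

omit [NumberField F] in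
/-- The solutions of `D w² - u² = m` inject into the divisors `√D w - u` of `m` in any extension
of `F` that contains a square root of `D`. -/
theorem card_le_of_sq_eq {E : Type u} [Field E] [NumberField E] [Algebra F E] {P C ε : ℝ}
    (hP : 1 ≤ P) {D m : 𝓞 F} (hD : D ≠ 0) (hm : m ≠ 0) {s : 𝓞 E}
    (hs : s ^ 2 = algebraMap (𝓞 F) (𝓞 E) D)
    (hC : ∀ (m : 𝓞 E), m ≠ 0 → (∀ φ : E →+* ℂ, ‖φ m‖ ≤ 2 * P) →
        ∀ T : Finset (𝓞 E), (∀ α ∈ T, α ∣ m ∧ ∀ φ : E →+* ℂ, ‖φ α‖ ≤ 2 * P) →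
          (T.card : ℝ) ≤ C * (2 * P) ^ ε)
    (hmP : ∀ σ : F →+* ℝ, |σ m| ≤ P) (T : Finset (𝓞 F × 𝓞 F))
    (hT : ∀ p ∈ T, D * p.2 ^ 2 - p.1 ^ 2 = m ∧ ∀ σ : F →+* ℝ,
      |σ D| * σ p.2 ^ 2 ≤ P ∧ σ p.1 ^ 2 ≤ P) :
    (T.card : ℝ) ≤ C * (2 * P) ^ ε := by
  classical
  let ι : 𝓞 F →+* 𝓞 E := algebraMap (𝓞 F) (𝓞 E)
  have hι : Function.Injective ι := FaithfulSMul.algebraMap_injective _ _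
  have hφ : ∀ (φ : E →+* ℂ) (a : 𝓞 F),
      ‖φ (ι a)‖ = |(realEmbeddingEquiv F).symm (φ.comp (algebraMap F E)) a| := fun φ a => by
    rw [← norm_embedding]; rfl
  have hs0 : s ≠ 0 := by
    rintro rfl
    rw [zero_pow two_ne_zero, ← map_zero ι] at hs
    exact hD (hι hs).symm
  let f : 𝓞 F × 𝓞 F → 𝓞 E := fun p => s * ι p.2 - ι p.1
  have hf : ∀ p ∈ T, f p * (s * ι p.2 + ι p.1) = ι m := fun p hp => by
    rw [← (hT p hp).1, map_sub, map_mul, map_pow, map_pow, ← show s ^ 2 = ι D from hs]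
    ring
  have hιm : ι m ≠ 0 := by rw [← map_zero ι]; exact hι.ne hm
  have hinj : Set.InjOn f T := by
    intro p hp q hq hpq
    have h1 := hf p hp
    have h2 := hf q hq
    rw [← hpq, ← h1] at h2
    have hfp : f p ≠ 0 := fun h0 => by rw [h0, zero_mul] at h1; exact hιm h1.symm
    have h3 := mul_left_cancel₀ hfp h2
    simp only [f] at hpq
    have h4 : (2 : 𝓞 E) * ι p.1 = 2 * ι q.1 := by linear_combination -hpq - h3
    have h5 : s * ι p.2 = s * ι q.2 := by
      have : (2 : 𝓞 E) * (s * ι p.2) = 2 * (s * ι q.2) := by linear_combination hpq - h3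
      exact mul_left_cancel₀ two_ne_zero this
    exact Prod.ext (hι (mul_left_cancel₀ two_ne_zero h4)) (hι (mul_left_cancel₀ hs0 h5))
  have := hC (ι m) hιm (fun φ => by
    rw [hφ]; exact (hmP _).trans (by linarith)) (T.image f) (by
      intro α hα
      obtain ⟨p, hp, rfl⟩ := Finset.mem_image.mp hα
      refine ⟨⟨_, (hf p hp).symm⟩, fun φ => ?_⟩
      obtain ⟨h1, h2⟩ := (hT p hp).2 ((realEmbeddingEquiv F).symm (φ.comp (algebraMap F E)))
      have h3 : ‖φ (ι p.1)‖ ≤ P := by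
        rw [hφ]
        exact abs_le_of_sq_le_sq (h2.trans (by nlinarith)) (by linarith)
      have h4 : ‖φ (s * ι p.2 : 𝓞 E)‖ ≤ P := by
        have h5 : ‖φ (s * ι p.2 : 𝓞 E)‖ ^ 2 ≤ P ^ 2 := by
          have h6 : ‖φ s‖ ^ 2 = ‖φ (ι D)‖ := by
            rw [← norm_pow, ← map_pow]
            congr 2
            exact congr_arg (algebraMap (𝓞 E) E) hs
          simp only [map_mul, norm_mul]
          rw [mul_pow, h6]
          have h7 := hφ φ p.2
          have h8 := hφ φ D
          refine le_trans (le_of_eq ?_) (h1.trans (by nlinarith))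
          exact congr_arg₂ (· * ·) h8 ((congr_arg (· ^ 2) h7).trans (sq_abs _))
        exact (pow_le_pow_iff_left₀ (norm_nonneg _) (by linarith) two_ne_zero).mp h5
      have h5 : φ (f p) = φ (s * ι p.2 : 𝓞 E) - φ (ι p.1) := by
        simp only [f, map_sub]
      rw [h5]
      exact (norm_sub_le _ _).trans (by linarith))
  rwa [Finset.card_image_of_injOn hinj] at this

omit [IsTotallyReal F] in
/-- A square root of `D` lives in a number field of degree at most twice that of `F` (which is `F`
itself when `D` is a square). -/
theorem exists_quadratic_extension (D : 𝓞 F) : ∃ (E : Type u) (_ : Field E) (_ : NumberField E)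
    (_ : Algebra F E) (s : 𝓞 E), Module.finrank ℚ E ≤ 2 * Module.finrank ℚ F ∧
      s ^ 2 = algebraMap (𝓞 F) (𝓞 E) D := by
  obtain ⟨s, hs⟩ := IsAlgClosed.exists_pow_nat_eq (algebraMap F (AlgebraicClosure F) D) two_pos
  let q : Polynomial F := Polynomial.X ^ 2 - Polynomial.C (D : F)
  have hq : q.Monic := Polynomial.monic_X_pow_sub_C _ two_ne_zero
  have hqs : Polynomial.aeval s q = 0 := by simp [q, hs]
  have hint : IsIntegral F s := ⟨q, hq, hqs⟩
  let E := IntermediateField.adjoin F {s}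
  have hfd : FiniteDimensional F E := IntermediateField.adjoin.finiteDimensional hint
  have hnf : NumberField E := NumberField.of_module_finite F E
  have hrank : Module.finrank F E ≤ 2 := by
    rw [IntermediateField.adjoin.finrank hint]
    refine (Polynomial.natDegree_le_of_dvd (minpoly.dvd F s hqs) hq.ne_zero).trans ?_
    exact (Polynomial.natDegree_X_pow_sub_C).le
  let t : E := ⟨s, IntermediateField.mem_adjoin_simple_self F s⟩
  have ht : t ^ 2 = algebraMap F E D := Subtype.ext hs
  have htint : IsIntegral ℤ t := by
    refine IsIntegral.of_pow two_pos ?_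
    rw [ht]
    exact (RingOfIntegers.isIntegral_coe D).algebraMap
  refine ⟨E, inferInstance, hnf, inferInstance, ⟨t, htint⟩, ?_, ?_⟩
  · rw [← Module.finrank_mul_finrank ℚ F E, mul_comm]
    exact Nat.mul_le_mul_right _ hrank
  · exact RingOfIntegers.ext ht

variable (F) in
/-- The equation `D w² - u² = m ≠ 0` has `≪ P^ε` integral solutions all of whose terms are
bounded by `P`. -/
theorem exists_card_sq_sub_sq_le {ε : ℝ} (hε : 0 < ε) : ∃ C : ℝ, 0 < C ∧
    ∀ P : ℝ, 1 ≤ P → ∀ D m : 𝓞 F, D ≠ 0 → m ≠ 0 → (∀ σ : F →+* ℝ, |σ m| ≤ P) →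
      ∀ T : Finset (𝓞 F × 𝓞 F), (∀ p ∈ T, D * p.2 ^ 2 - p.1 ^ 2 = m ∧ ∀ σ : F →+* ℝ,
        |σ D| * σ p.2 ^ 2 ≤ P ∧ σ p.1 ^ 2 ≤ P) → (T.card : ℝ) ≤ C * P ^ ε := by
  obtain ⟨C, hC, h⟩ := exists_card_divisors_le.{u} (2 * Module.finrank ℚ F) hε
  refine ⟨C * 2 ^ ε, by positivity, fun P hP D m hD hm hmP T hT => ?_⟩
  obtain ⟨E, _, _, _, s, hrank, hs⟩ := exists_quadratic_extension D
  refine (card_le_of_sq_eq hP hD hm hs (h E hrank (2 * P) (by linarith)) hmP T hT).trans_eq ?_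
  rw [Real.mul_rpow zero_le_two (by linarith), mul_assoc]

end NumberField

/-! ### Reduced quaternary forms -/

namespace QForm

variable {F : Type*} [Field F] [NumberField F] {n : ℕ}

theorem eval_add {A : Matrix (Fin n) (Fin n) (𝓞 F)} (hA : A.IsSymm) (x y : Fin n → F) :
    eval A (x + y) = eval A x + eval A y + bilin A x y := by
  have h := bilin_self A (x + y)
  have hs := (bilin_isSymm hA).eq x y
  simp only [map_add, LinearMap.add_apply, bilin_self] at h
  have h2 : (2 : F) ≠ 0 := two_ne_zero
  apply mul_left_cancel₀ h2
  rw [← h]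
  linear_combination -hs

theorem toField_apply_eq {A : Matrix (Fin n) (Fin n) (𝓞 F)} (hA : A.IsSymm) (i j : Fin n) :
    toField A i j = eval A (Pi.single i 1 + Pi.single j 1) - eval A (Pi.single i 1)
      - eval A (Pi.single j 1) := by
  rw [eval_add hA, bilin_apply, mulVec_single_one, single_one_dotProduct]
  simp only [Matrix.col_apply]
  ring

/-- The part of a quasi-diagonal quaternary form that does not involve the first variable. -/
def tailDiag (h : Fin 4 → F) (c : Fin 4 → Fin 4 → F) (x₁ x₂ x₃ : F) : F :=
  h 1 * (x₁ + (c 1 2 * x₂ + c 1 3 * x₃)) ^ 2 + h 2 * (x₂ + c 2 3 * x₃) ^ 2 + h 3 * x₃ ^ 2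

/-- The diagonalization of a reduced quaternary form, written out. -/
def quasiDiag (h : Fin 4 → F) (c : Fin 4 → Fin 4 → F) (x : Fin 4 → F) : F :=
  h 0 * (x 0 + (c 0 1 * x 1 + c 0 2 * x 2 + c 0 3 * x 3)) ^ 2 + tailDiag h c (x 1) (x 2) (x 3)

omit [NumberField F] in
theorem IsReduced.eval_eq_quasiDiag {K : ℝ} {B : Matrix (Fin 4) (Fin 4) (𝓞 F)} {h : Fin 4 → F}
    {c : Fin 4 → Fin 4 → F} (hB : IsReduced K B h c) (x : Fin 4 → F) :
    eval B x = quasiDiag h c x := by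
  have e0 : Finset.Ioi (0 : Fin 4) = {1, 2, 3} := by decide
  have e1 : Finset.Ioi (1 : Fin 4) = {2, 3} := by decide
  have e2 : Finset.Ioi (2 : Fin 4) = {3} := by decide
  have e3 : Finset.Ioi (3 : Fin 4) = ∅ := by decide
  rw [hB.eval_eq, Fin.sum_univ_four, e0, e1, e2, e3, quasiDiag, tailDiag]
  simp [add_assoc]

/-- The matrix of a form in quasi-diagonal shape. -/
def quasiDiagMatrix (h : Fin 4 → F) (c : Fin 4 → Fin 4 → F) : Matrix (Fin 4) (Fin 4) F :=
  !![2 * h 0, 2 * h 0 * c 0 1, 2 * h 0 * c 0 2, 2 * h 0 * c 0 3;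
    2 * h 0 * c 0 1, 2 * h 0 * c 0 1 ^ 2 + 2 * h 1,
      2 * h 0 * c 0 1 * c 0 2 + 2 * h 1 * c 1 2, 2 * h 0 * c 0 1 * c 0 3 + 2 * h 1 * c 1 3;
    2 * h 0 * c 0 2, 2 * h 0 * c 0 1 * c 0 2 + 2 * h 1 * c 1 2,
      2 * h 0 * c 0 2 ^ 2 + 2 * h 1 * c 1 2 ^ 2 + 2 * h 2,
      2 * h 0 * c 0 2 * c 0 3 + 2 * h 1 * c 1 2 * c 1 3 + 2 * h 2 * c 2 3;
    2 * h 0 * c 0 3, 2 * h 0 * c 0 1 * c 0 3 + 2 * h 1 * c 1 3,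
      2 * h 0 * c 0 2 * c 0 3 + 2 * h 1 * c 1 2 * c 1 3 + 2 * h 2 * c 2 3,
      2 * h 0 * c 0 3 ^ 2 + 2 * h 1 * c 1 3 ^ 2 + 2 * h 2 * c 2 3 ^ 2 + 2 * h 3]

theorem IsReduced.toField_eq {K : ℝ} {B : Matrix (Fin 4) (Fin 4) (𝓞 F)} {h : Fin 4 → F}
    {c : Fin 4 → Fin 4 → F} (hB : IsReduced K B h c) (hs : B.IsSymm) :
    toField B = quasiDiagMatrix h c := by
  ext i j
  rw [toField_apply_eq hs, hB.eval_eq_quasiDiag, hB.eval_eq_quasiDiag, hB.eval_eq_quasiDiag]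
  fin_cases i <;> fin_cases j <;>
  · simp [quasiDiag, tailDiag, quasiDiagMatrix]
    try ring

omit [NumberField F] in
theorem det_quasiDiagMatrix (h : Fin 4 → F) (c : Fin 4 → Fin 4 → F) :
    (quasiDiagMatrix h c).det = 16 * (h 0 * h 1 * h 2 * h 3) := by
  rw [Matrix.det_succ_row_zero, Fin.sum_univ_four]
  simp [quasiDiagMatrix, Matrix.det_fin_three, Fin.succAbove]
  ring

omit [NumberField F] in
theorem adjugate_quasiDiagMatrix (h : Fin 4 → F) (c : Fin 4 → Fin 4 → F) :
    (quasiDiagMatrix h c).adjugate 3 3 = 8 * (h 0 * h 1 * h 2) := by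
  rw [adjugate_fin_succ_eq_det_submatrix]
  simp [quasiDiagMatrix, Matrix.det_fin_three, Fin.succAbove]
  ring

theorem IsReduced.det_eq {K : ℝ} {B : Matrix (Fin 4) (Fin 4) (𝓞 F)} {h : Fin 4 → F}
    {c : Fin 4 → Fin 4 → F} (hB : IsReduced K B h c) (hs : B.IsSymm) :
    (B.det : F) = 16 * (h 0 * h 1 * h 2 * h 3) := by
  rw [← det_quasiDiagMatrix h c, ← hB.toField_eq hs]
  exact RingHom.map_det (algebraMap (𝓞 F) F) B

theorem IsReduced.adjugate_eq {K : ℝ} {B : Matrix (Fin 4) (Fin 4) (𝓞 F)} {h : Fin 4 → F}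
    {c : Fin 4 → Fin 4 → F} (hB : IsReduced K B h c) (hs : B.IsSymm) :
    (B.adjugate 3 3 : F) = 8 * (h 0 * h 1 * h 2) := by
  rw [← adjugate_quasiDiagMatrix h c, ← hB.toField_eq hs]
  exact congr_fun (congr_fun (RingHom.map_adjugate (algebraMap (𝓞 F) F) B) 3) 3

/-- Completing the square in the first variable. -/
theorem IsReduced.four_mul_eval {K : ℝ} {B : Matrix (Fin 4) (Fin 4) (𝓞 F)} {h : Fin 4 → F}
    {c : Fin 4 → Fin 4 → F} (hB : IsReduced K B h c) (hs : B.IsSymm) (x : Fin 4 → 𝓞 F) :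
    2 * (B 0 0 : F) * eval B (fun i => (x i : F)) - ((B *ᵥ x) 0 : F) ^ 2
      = 4 * h 0 * tailDiag h c (x 1) (x 2) (x 3) := by
  have h1 : ∀ j, (B 0 j : F) = quasiDiagMatrix h c 0 j := fun j => by
    rw [← hB.toField_eq hs]; rfl
  have h2 : ((B *ᵥ x) 0 : F) = ∑ j, (B 0 j : F) * x j := by simp [mulVec, dotProduct]
  rw [hB.eval_eq_quasiDiag, h2, Fin.sum_univ_four, h1, h1, h1, h1]
  simp [quasiDiagMatrix, quasiDiag]
  ring

end QForm

/-! ### Counting with reduced forms -/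

namespace QForm

variable {F : Type*} [Field F] [NumberField F]

/-- The size of a box of integers `x` with `h^σ (x^σ + ρ_σ)² ≤ Y` for all `σ`. -/
noncomputable def boxSize (Y : ℝ) (h : F) : ℝ := ∏ σ : F →+* ℝ, (2 * √(Y / σ h) + 1)

theorem boxSize_nonneg (Y : ℝ) (h : F) : 0 ≤ boxSize Y h :=
  Finset.prod_nonneg fun _ _ => by positivity

theorem card_le_boxSize [IsTotallyReal F] {Y : ℝ} {h : F} (hh : ∀ σ : F →+* ℝ, 0 < σ h) (ρ : F)
    (T : Finset (𝓞 F)) (hT : ∀ a ∈ T, ∀ σ : F →+* ℝ, σ (h * (a + ρ) ^ 2) ≤ Y) :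
    (T.card : ℝ) ≤ boxSize Y h := by
  refine card_le_of_abs_sub_le T (fun σ => -σ ρ) _ (fun σ => Real.sqrt_nonneg _) fun a ha σ => ?_
  have h1 := hT a ha σ
  rw [map_mul, map_pow, map_add] at h1
  rw [sub_neg_eq_add]
  apply Real.abs_le_sqrt
  rw [le_div_iff₀ (hh σ)]
  linarith

/-- Counting the last three coordinates one at a time. -/
theorem card_triples_le [IsTotallyReal F] {Y : ℝ} {h : Fin 4 → F}
    (hh : ∀ (σ : F →+* ℝ) (j : Fin 4), 0 < σ (h j)) (c : Fin 4 → Fin 4 → F)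
    (T : Finset (𝓞 F × 𝓞 F × 𝓞 F))
    (hT : ∀ t ∈ T, ∀ σ : F →+* ℝ, σ (tailDiag h c t.1 t.2.1 t.2.2) ≤ Y) :
    (T.card : ℝ) ≤ boxSize Y (h 1) * (boxSize Y (h 2) * boxSize Y (h 3)) := by
  classical
  have hsq : ∀ (σ : F →+* ℝ) (j : Fin 4) (a : F), 0 ≤ σ (h j * a ^ 2) := fun σ j a => by
    rw [map_mul, map_pow]
    have := hh σ j
    positivity
  have hT1 : ∀ t ∈ T, ∀ σ : F →+* ℝ,
      σ (h 1 * (t.1 + (c 1 2 * t.2.1 + c 1 3 * t.2.2)) ^ 2) ≤ Y := fun t ht σ => by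
    have h1 := hT t ht σ
    rw [tailDiag, map_add, map_add] at h1
    have h2 := hsq σ 2 (t.2.1 + c 2 3 * t.2.2)
    have h3 := hsq σ 3 t.2.2
    linarith
  have hT2 : ∀ t ∈ T, ∀ σ : F →+* ℝ, σ (h 2 * (t.2.1 + c 2 3 * t.2.2) ^ 2) ≤ Y :=
    fun t ht σ => by
    have h1 := hT t ht σ
    rw [tailDiag, map_add, map_add] at h1
    have h2 := hsq σ 1 (t.1 + (c 1 2 * t.2.1 + c 1 3 * t.2.2))
    have h3 := hsq σ 3 t.2.2
    linarith
  have hT3 : ∀ t ∈ T, ∀ σ : F →+* ℝ, σ (h 3 * t.2.2 ^ 2) ≤ Y := fun t ht σ => by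
    have h1 := hT t ht σ
    rw [tailDiag, map_add, map_add] at h1
    have h2 := hsq σ 1 (t.1 + (c 1 2 * t.2.1 + c 1 3 * t.2.2))
    have h3 := hsq σ 2 (t.2.1 + c 2 3 * t.2.2)
    linarith
  -- fibre over the last coordinate, then over the middle one
  have hstep : ∀ {α β : Type _} [DecidableEq β] (S : Finset (α × β)) (a b : ℝ), 0 ≤ a →
      (∀ y ∈ S.image Prod.snd, ({t ∈ S | t.2 = y}.card : ℝ) ≤ a) →
      ((S.image Prod.snd).card : ℝ) ≤ b → (S.card : ℝ) ≤ a * b := by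
    intro α β _ S a b ha h1 h2
    have h3 : S.card ≤ ⌊a⌋₊ * (S.image Prod.snd).card :=
      Finset.card_le_mul_card_image S _ fun y hy => Nat.le_floor (h1 y hy)
    calc (S.card : ℝ) ≤ (⌊a⌋₊ : ℝ) * (S.image Prod.snd).card := by exact_mod_cast h3
      _ ≤ a * b := mul_le_mul (Nat.floor_le ha) h2 (by positivity) ha
  refine hstep T _ _ (boxSize_nonneg _ _) (fun y _ => ?_)
    (hstep _ _ _ (boxSize_nonneg _ _) (fun z _ => ?_) ?_)
  · rw [← Finset.card_image_of_injOn (f := Prod.fst) (fun t ht t' ht' e => Prod.ext e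
      ((Finset.mem_filter.mp ht).2.trans (Finset.mem_filter.mp ht').2.symm))]
    refine card_le_boxSize (fun σ => hh σ 1) (c 1 2 * y.1 + c 1 3 * y.2) _ fun a ha σ => ?_
    obtain ⟨t, ht, rfl⟩ := Finset.mem_image.mp ha
    obtain ⟨ht', rfl⟩ := Finset.mem_filter.mp ht
    exact hT1 t ht' σ
  · rw [← Finset.card_image_of_injOn (f := Prod.fst) (fun t ht t' ht' e => Prod.ext e
      ((Finset.mem_filter.mp ht).2.trans (Finset.mem_filter.mp ht').2.symm))]
    refine card_le_boxSize (fun σ => hh σ 2) (c 2 3 * z) _ fun a ha σ => ?_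
    obtain ⟨t, ht, rfl⟩ := Finset.mem_image.mp ha
    obtain ⟨ht', rfl⟩ := Finset.mem_filter.mp ht
    obtain ⟨s, hs, rfl⟩ := Finset.mem_image.mp ht'
    exact hT2 s hs σ
  · refine card_le_boxSize (fun σ => hh σ 3) 0 _ fun a ha σ => ?_
    obtain ⟨t, ht, rfl⟩ := Finset.mem_image.mp ha
    obtain ⟨s, hs, rfl⟩ := Finset.mem_image.mp ht
    rw [add_zero]
    exact hT3 s hs σ

/-- For an ascending sequence of side lengths, the products over all subsets are dominated by the
products over initial segments. -/
theorem prod_one_add_le {k X₁ X₂ X₃ : ℝ} (hk : 0 ≤ k) (h1 : 0 ≤ X₁) (h2 : 0 ≤ X₂) (h3 : 0 ≤ X₃)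
    (h12 : X₂ ≤ k * X₁) (h23 : X₃ ≤ k * X₂) : (1 + X₁) * ((1 + X₂) * (1 + X₃))
      ≤ (1 + k + k ^ 2) * (1 + X₁ + X₁ * X₂ + X₁ * X₂ * X₃) := by
  have e1 : X₃ ≤ k ^ 2 * X₁ := by nlinarith
  have e2 : X₁ * X₃ ≤ k * (X₁ * X₂) := by nlinarith
  have e3 : X₂ * X₃ ≤ k ^ 2 * (X₁ * X₂) := by
    have : X₂ * X₃ ≤ X₂ * (k ^ 2 * X₁) := mul_le_mul_of_nonneg_left e1 h2
    linarith
  have p1 : 0 ≤ X₁ * X₂ := by positivity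
  have p2 : 0 ≤ X₁ * X₂ * X₃ := by positivity
  have p3 : 0 ≤ (k + k ^ 2) * (1 + X₁ * X₂ * X₃) := by positivity
  nlinarith

theorem add_four_pow_le {a b c e : ℝ} (ha : 0 ≤ a) (hb : 0 ≤ b) (hc : 0 ≤ c) (he : 0 ≤ e)
    (d : ℕ) : (a + b + c + e) ^ d ≤ 4 ^ d * (a ^ d + b ^ d + c ^ d + e ^ d) := by
  obtain ⟨m, hm, hle, hm'⟩ : ∃ m : ℝ, 0 ≤ m ∧ a + b + c + e ≤ 4 * m ∧
      m ^ d ≤ a ^ d + b ^ d + c ^ d + e ^ d := by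
    have pa := pow_nonneg ha d
    have pb := pow_nonneg hb d
    have pc := pow_nonneg hc d
    have pe := pow_nonneg he d
    rcases le_total a b with h | h <;> rcases le_total c e with h' | h'
    · rcases le_total b e with h'' | h''
      · exact ⟨e, he, by linarith, by linarith⟩
      · exact ⟨b, hb, by linarith, by linarith⟩
    · rcases le_total b c with h'' | h''
      · exact ⟨c, hc, by linarith, by linarith⟩
      · exact ⟨b, hb, by linarith, by linarith⟩
    · rcases le_total a e with h'' | h''
      · exact ⟨e, he, by linarith, by linarith⟩
      · exact ⟨a, ha, by linarith, by linarith⟩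
    · rcases le_total a c with h'' | h''
      · exact ⟨c, hc, by linarith, by linarith⟩
      · exact ⟨a, ha, by linarith, by linarith⟩
  calc (a + b + c + e) ^ d ≤ (4 * m) ^ d := pow_le_pow_left₀ (by positivity) hle d
    _ = 4 ^ d * m ^ d := mul_pow _ _ _
    _ ≤ _ := by gcongr

/-- The three-term bound for the number of triples, with `z` in place of `y₁ y₂²`. -/
noncomputable def mainTerm (A : Matrix (Fin 4) (Fin 4) (𝓞 F)) (z : ℝ) : ℝ :=
  z ^ (3 / 2 : ℝ) / normDet A ^ (1 / 2 : ℝ) + z / (normDet A / normLevel A) ^ (1 / 2 : ℝ)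
    + z ^ (1 / 2 : ℝ)

omit [NumberField F] in
theorem IsReduced.pos {K : ℝ} (hK : 0 < K) {n : ℕ} {B : Matrix (Fin n) (Fin n) (𝓞 F)}
    {h : Fin n → F} {c : Fin n → Fin n → F} (hB : IsReduced K B h c) (σ : F →+* ℝ) (j : Fin n) :
    0 < σ (h j) :=
  pos_of_mul_pos_right (one_pos.trans_le (hB.one_le σ j)) hK.le

theorem pow_le_sqrt_mul {X Y H K G t : ℝ} {d m : ℕ} (hK : 0 ≤ K) (hY : 0 ≤ Y) (hH : 0 < H)
    (hG : 0 < G) (ht : 0 ≤ t) (hX : X ^ 2 = Y ^ m / H) (hGH : G ≤ (K * H) ^ d)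
    (htG : t ^ 2 = (Y ^ d) ^ m / G) : X ^ d ≤ √(K ^ d) * t := by
  have h1 : (X ^ d) ^ 2 ≤ K ^ d * t ^ 2 := by
    rw [pow_right_comm, hX, htG, div_pow, mul_div_assoc', div_le_div_iff₀ (by positivity) hG,
      pow_right_comm Y]
    calc (Y ^ d) ^ m * G ≤ (Y ^ d) ^ m * (K * H) ^ d := by gcongr
      _ = _ := by rw [mul_pow]; ring
  refine (Real.le_sqrt_of_sq_le h1).trans_eq ?_
  rw [Real.sqrt_mul (by positivity), Real.sqrt_sq ht]

/-- The number of triples in the box of a reduced form. Up to constants the conjugates of each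
`h_j` are equal, and `h_j` is ascending in `j`, so only the products `h₂`, `h₂ h₃`, `h₂ h₃ h₄`
matter; their norms are bounded below in terms of `N(Δ)` and `N(𝔫)`. -/
theorem exists_boxSize_mul_le [IsTotallyReal F] {K : ℝ} (hK : 0 < K) : ∃ C : ℝ, 0 < C ∧
    ∀ (A : Matrix (Fin 4) (Fin 4) (𝓞 F)) (B : Matrix (Fin 4) (Fin 4) (𝓞 F)) (h : Fin 4 → F)
      (c : Fin 4 → Fin 4 → F), IsReduced K B h c → (∀ σ : F →+* ℝ, σ (h 0) ≤ K) →
      1 ≤ normDet A → normDet A ≤ absN (16 * (h 0 * h 1 * h 2 * h 3)) →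
      normDet A ≤ absN (8 * (h 0 * h 1 * h 2)) * normLevel A → ∀ z : ℝ, 1 ≤ z →
      boxSize (z ^ (1 / (Module.finrank ℚ F : ℝ))) (h 1) *
        (boxSize (z ^ (1 / (Module.finrank ℚ F : ℝ))) (h 2) *
          boxSize (z ^ (1 / (Module.finrank ℚ F : ℝ))) (h 3)) ≤ C * mainTerm A z := by
  set d := Fintype.card (F →+* ℝ) with hd
  set k := √K with hk
  have hk0 : 0 < k := Real.sqrt_pos.mpr hK
  set C₀ : ℝ := ((1 + 2 * k) ^ 3 * (1 + k + k ^ 2)) ^ d * 4 ^ d with hC₀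
  set C₁ : ℝ := 1 + √(K ^ d) + √((8 * K ^ 3) ^ d) + √((16 * K ^ 4) ^ d) with hC₁
  refine ⟨C₀ * C₁, by positivity, fun A B h c hB h0K hΔ hdet hlev z hz => ?_⟩
  have hz0 : 0 < z := by linarith
  set Y := z ^ (1 / (Module.finrank ℚ F : ℝ)) with hY
  have hYd : Y ^ d = z := rpow_one_div_pow_card hz0.le
  have hY1 : 1 ≤ Y := Real.one_le_rpow hz (by positivity)
  have hY0 : 0 < Y := by linarith
  have hpos := hB.pos hK
  have σ₀ : F →+* ℝ := Classical.arbitrary _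
  set H : Fin 4 → ℝ := fun j => σ₀ (h j) with hH
  have hH0 : ∀ j, 0 < H j := hpos σ₀
  set X : Fin 4 → ℝ := fun j => √(Y / H j) with hX
  have hX0 : ∀ j, 0 ≤ X j := fun j => Real.sqrt_nonneg _
  have hXle : ∀ (σ : F →+* ℝ) (i j : Fin 4), i ≤ j → √(Y / σ (h j)) ≤ k * √(Y / H i) := by
    intro σ i j hij
    rw [hk, ← Real.sqrt_mul hK.le]
    refine Real.sqrt_le_sqrt ?_
    rw [mul_div_assoc', div_le_div_iff₀ (hpos σ j) (hH0 i)]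
    have := hB.mono σ₀ σ i j hij
    have h2 : Y * H i ≤ Y * (K * σ (h j)) := mul_le_mul_of_nonneg_left this hY0.le
    linarith
  have hbox : ∀ j, boxSize Y (h j) ≤ ((1 + 2 * k) * (1 + X j)) ^ d := by
    intro j
    rw [boxSize, hd, ← Finset.card_univ, ← Finset.prod_const]
    refine Finset.prod_le_prod (fun _ _ => by positivity) fun σ _ => ?_
    have := hXle σ j j le_rfl
    have h2 := hX0 j
    simp only [hX] at h2 ⊢
    nlinarith
  have h12 : X 2 ≤ k * X 1 := hXle σ₀ 1 2 (by decide)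
  have h23 : X 3 ≤ k * X 2 := hXle σ₀ 2 3 (by decide)
  have habsN : ∀ j, absN (h j) ≤ (K * H j) ^ d := by
    intro j
    rw [absN, hd, ← Finset.card_univ, ← Finset.prod_const]
    refine Finset.prod_le_prod (fun _ _ => abs_nonneg _) fun σ _ => ?_
    rw [abs_of_pos (hpos σ j)]
    exact hB.mono σ σ₀ j j le_rfl
  have habsN0 : absN (h 0) ≤ K ^ d := by
    rw [absN, hd, ← Finset.card_univ, ← Finset.prod_const]
    refine Finset.prod_le_prod (fun _ _ => abs_nonneg _) fun σ _ => ?_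
    rw [abs_of_pos (hpos σ 0)]
    exact h0K σ
  have hN : 0 ≤ normLevel A := Nat.cast_nonneg _
  have hN' : 0 < normLevel A := by
    rcases hN.eq_or_lt with h0 | h0
    · rw [← h0, mul_zero] at hlev; linarith
    · exact h0
  have hΔ0 : 0 < normDet A := by linarith
  have hXsq : ∀ j, X j ^ 2 = Y / H j := fun j => Real.sq_sqrt (div_nonneg hY0.le (hH0 j).le)
  have hH1 := hH0 1
  have hH2 := hH0 2
  have hH3 := hH0 3
  have h8 : absN (8 : F) = 8 ^ d := by
    have := absN_natCast (F := F) 8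
    simpa using this
  have h16 : absN (16 : F) = 16 ^ d := by
    have := absN_natCast (F := F) 16
    simpa using this
  have n01 : absN (h 0) * absN (h 1) ≤ K ^ d * (K * H 1) ^ d :=
    mul_le_mul habsN0 (habsN 1) (absN_nonneg _) (by positivity)
  have n012 : absN (h 0) * absN (h 1) * absN (h 2) ≤ K ^ d * (K * H 1) ^ d * (K * H 2) ^ d :=
    mul_le_mul n01 (habsN 2) (absN_nonneg _) (by positivity)
  have n0123 : absN (h 0) * absN (h 1) * absN (h 2) * absN (h 3)
      ≤ K ^ d * (K * H 1) ^ d * (K * H 2) ^ d * (K * H 3) ^ d :=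
    mul_le_mul n012 (habsN 3) (absN_nonneg _) (by positivity)
  -- the four terms of the expanded product
  have t1 : X 1 ^ d ≤ √(K ^ d) * z ^ (1 / 2 : ℝ) := by
    refine pow_le_sqrt_mul (m := 1) hK.le hY0.le hH1 one_pos (by positivity) ?_
      (one_le_pow₀ (hB.one_le σ₀ 1)) ?_
    · rw [hXsq, pow_one]
    · rw [sq_rpow_half hz0.le, hYd, pow_one, div_one]
  have t2 : (X 1 * X 2) ^ d ≤ √((8 * K ^ 3) ^ d) *
      (z / (normDet A / normLevel A) ^ (1 / 2 : ℝ)) := by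
    refine pow_le_sqrt_mul (m := 2) (H := H 1 * H 2) (G := normDet A / normLevel A) (by positivity)
      hY0.le (by positivity) (by positivity) (by positivity) ?_ ?_ ?_
    · rw [mul_pow, hXsq, hXsq, div_mul_div_comm, sq]
    · rw [div_le_iff₀ hN']
      refine hlev.trans (mul_le_mul_of_nonneg_right ?_ hN)
      rw [absN_mul, absN_mul, absN_mul, h8]
      refine (mul_le_mul_of_nonneg_left n012 (by positivity)).trans_eq ?_
      rw [← mul_pow, ← mul_pow, ← mul_pow]
      ring
    · rw [div_pow, sq_rpow_half (by positivity), hYd]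
  have t3 : (X 1 * X 2 * X 3) ^ d ≤ √((16 * K ^ 4) ^ d) *
      (z ^ (3 / 2 : ℝ) / normDet A ^ (1 / 2 : ℝ)) := by
    refine pow_le_sqrt_mul (m := 3) (H := H 1 * H 2 * H 3) (G := normDet A) (by positivity)
      hY0.le (by positivity) hΔ0 (by positivity) ?_ ?_ ?_
    · rw [mul_pow, mul_pow, hXsq, hXsq, hXsq, div_mul_div_comm, div_mul_div_comm]
      ring
    · refine hdet.trans ?_
      rw [absN_mul, absN_mul, absN_mul, absN_mul, h16]
      refine (mul_le_mul_of_nonneg_left n0123 (by positivity)).trans_eq ?_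
      rw [← mul_pow, ← mul_pow, ← mul_pow, ← mul_pow]
      ring
    · rw [div_pow, sq_rpow_half hΔ0.le, sq_rpow_three_halves hz0.le, hYd]
  have t0 : (1 : ℝ) ^ d ≤ z ^ (1 / 2 : ℝ) := by
    rw [one_pow]; exact Real.one_le_rpow hz (by positivity)
  have hsum : (1 : ℝ) ^ d + X 1 ^ d + (X 1 * X 2) ^ d + (X 1 * X 2 * X 3) ^ d
      ≤ C₁ * mainTerm A z := by
    have m1 : 0 ≤ z ^ (1 / 2 : ℝ) := by positivity
    have m2 : 0 ≤ z / (normDet A / normLevel A) ^ (1 / 2 : ℝ) := by positivity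
    have m3 : 0 ≤ z ^ (3 / 2 : ℝ) / normDet A ^ (1 / 2 : ℝ) := by positivity
    have s1 : 0 ≤ √(K ^ d) := Real.sqrt_nonneg _
    have s2 : 0 ≤ √((8 * K ^ 3) ^ d) := Real.sqrt_nonneg _
    have s3 : 0 ≤ √((16 * K ^ 4) ^ d) := Real.sqrt_nonneg _
    rw [hC₁, mainTerm]
    generalize √(K ^ d) = r1 at *
    generalize √((8 * K ^ 3) ^ d) = r2 at *
    generalize √((16 * K ^ 4) ^ d) = r3 at *
    generalize z ^ (1 / 2 : ℝ) = w1 at *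
    generalize z / (normDet A / normLevel A) ^ (1 / 2 : ℝ) = w2 at *
    generalize z ^ (3 / 2 : ℝ) / normDet A ^ (1 / 2 : ℝ) = w3 at *
    have : 0 ≤ r1 * w2 + r1 * w3 + r2 * w1 + r2 * w3 + r3 * w1 + r3 * w2 + w2 + w3 := by
      positivity
    linarith
  have hX1 := hX0 1
  have hX2 := hX0 2
  have hX3 := hX0 3
  calc boxSize Y (h 1) * (boxSize Y (h 2) * boxSize Y (h 3))
      ≤ ((1 + 2 * k) * (1 + X 1)) ^ d *
        (((1 + 2 * k) * (1 + X 2)) ^ d * ((1 + 2 * k) * (1 + X 3)) ^ d) := by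
        refine mul_le_mul (hbox 1) (mul_le_mul (hbox 2) (hbox 3) (boxSize_nonneg _ _) ?_)
          (mul_nonneg (boxSize_nonneg _ _) (boxSize_nonneg _ _)) ?_ <;> positivity
    _ = ((1 + 2 * k) ^ 3 * ((1 + X 1) * ((1 + X 2) * (1 + X 3)))) ^ d := by
        rw [← mul_pow, ← mul_pow]; ring
    _ ≤ ((1 + 2 * k) ^ 3 * ((1 + k + k ^ 2) *
        (1 + X 1 + X 1 * X 2 + X 1 * X 2 * X 3))) ^ d := by
        refine pow_le_pow_left₀ (by positivity) (mul_le_mul_of_nonneg_left ?_ (by positivity)) d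
        exact prod_one_add_le hk0.le hX1 hX2 hX3 h12 h23
    _ = ((1 + 2 * k) ^ 3 * (1 + k + k ^ 2)) ^ d *
        (1 + X 1 + X 1 * X 2 + X 1 * X 2 * X 3) ^ d := by rw [← mul_assoc, mul_pow]
    _ ≤ ((1 + 2 * k) ^ 3 * (1 + k + k ^ 2)) ^ d * (4 ^ d * (C₁ * mainTerm A z)) := by
        refine mul_le_mul_of_nonneg_left ?_ (by positivity)
        refine (add_four_pow_le zero_le_one hX1 (by positivity) (by positivity) d).trans ?_
        exact mul_le_mul_of_nonneg_left hsum (by positivity)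
    _ = _ := by rw [hC₀]; ring

end QForm

/-! ### Representations of numbers `ℓ₁ ℓ₂²` -/

namespace QForm

variable {F : Type*} [Field F] [NumberField F]

theorem tailDiag_nonneg {h : Fin 4 → F} {σ : F →+* ℝ} (hh : ∀ j, 0 < σ (h j))
    (c : Fin 4 → Fin 4 → F) (x₁ x₂ x₃ : F) : 0 ≤ σ (tailDiag h c x₁ x₂ x₃) := by
  have h1 := hh 1
  have h2 := hh 2
  have h3 := hh 3
  simp only [tailDiag, map_add, map_mul, map_pow]
  positivity

theorem tailDiag_pos {h : Fin 4 → F} {σ : F →+* ℝ} (hh : ∀ j, 0 < σ (h j))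
    (c : Fin 4 → Fin 4 → F) {x₁ x₂ x₃ : F} (hx : ¬ (x₁ = 0 ∧ x₂ = 0 ∧ x₃ = 0)) :
    0 < σ (tailDiag h c x₁ x₂ x₃) := by
  refine (tailDiag_nonneg hh c x₁ x₂ x₃).lt_of_ne fun h0 => hx ?_
  have hz : ∀ (j : Fin 4) (a : F), 0 ≤ σ (h j * a ^ 2) ∧ (σ (h j * a ^ 2) = 0 → a = 0) :=
    fun j a => by
    rw [map_mul, map_pow]
    have := hh j
    refine ⟨by positivity, fun h => ?_⟩
    simpa [this.ne'] using h
  obtain ⟨p1, q1⟩ := hz 1 (x₁ + (c 1 2 * x₂ + c 1 3 * x₃))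
  obtain ⟨p2, q2⟩ := hz 2 (x₂ + c 2 3 * x₃)
  obtain ⟨p3, q3⟩ := hz 3 x₃
  rw [tailDiag, map_add, map_add] at h0
  have r3 := q3 (by linarith)
  have r2 := q2 (by linarith)
  have r1 := q1 (by linarith)
  rw [r3, mul_zero, add_zero] at r2
  rw [r3, r2, mul_zero, mul_zero, add_zero, add_zero] at r1
  exact ⟨r1, r2, r3⟩

omit [NumberField F] in
theorem eval_equivalent {n : ℕ} (A : Matrix (Fin n) (Fin n) (𝓞 F))
    (U : Matrix (Fin n) (Fin n) (𝓞 F)) (x : Fin n → 𝓞 F) :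
    eval (Uᵀ * A * U) (fun i => (x i : F)) = eval A (fun i => ((U *ᵥ x) i : F)) := by
  have h : ∀ (M : Matrix (Fin n) (Fin n) (𝓞 F)) (v : Fin n → 𝓞 F),
      eval M (fun i => (v i : F)) = 1 / 2 * ((v ⬝ᵥ (M *ᵥ v) : 𝓞 F) : F) := fun M v => by
    rw [eval, toField_mulVec_coe, coe_dotProduct]
  have hdot : x ⬝ᵥ ((Uᵀ * A * U) *ᵥ x) = (U *ᵥ x) ⬝ᵥ (A *ᵥ (U *ᵥ x)) := by
    rw [← mulVec_mulVec, ← mulVec_mulVec, dotProduct_mulVec, vecMul_transpose]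
  rw [h, h, hdot]

omit [NumberField F] in
theorem reps_equivalent {n : ℕ} (A : Matrix (Fin n) (Fin n) (𝓞 F)) (U : GL (Fin n) (𝓞 F))
    (ℓ : 𝓞 F) : reps A ℓ = (fun x => (U : Matrix (Fin n) (Fin n) (𝓞 F)) *ᵥ x) ''
      reps ((U : Matrix (Fin n) (Fin n) (𝓞 F))ᵀ * A * U) ℓ := by
  ext x
  constructor
  · intro hx
    have hUx : (U : Matrix (Fin n) (Fin n) (𝓞 F)) *ᵥ
        (((U⁻¹ : GL (Fin n) (𝓞 F)) : Matrix (Fin n) (Fin n) (𝓞 F)) *ᵥ x) = x := by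
      rw [mulVec_mulVec, Units.mul_inv, one_mulVec]
    refine ⟨((U⁻¹ : GL (Fin n) (𝓞 F)) : Matrix (Fin n) (Fin n) (𝓞 F)) *ᵥ x, ?_, hUx⟩
    rw [reps, Set.mem_ofPred_eq, eval_equivalent, hUx]
    exact hx
  · rintro ⟨x, hx, rfl⟩
    rw [reps, Set.mem_ofPred_eq, eval_equivalent] at hx
    exact hx

omit [NumberField F] in
theorem mulVec_unit_injective {n : ℕ} (U : GL (Fin n) (𝓞 F)) :
    Function.Injective fun x => (U : Matrix (Fin n) (Fin n) (𝓞 F)) *ᵥ x :=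
  Matrix.mulVec_injective_of_isUnit U.isUnit

variable [IsTotallyReal F]

theorem card_box_le {y : ℝ} (hy : 1 ≤ y) :
    ((box F y).card : ℝ) ≤ 3 ^ Fintype.card (F →+* ℝ) * y := by
  set Y := y ^ (1 / (Module.finrank ℚ F : ℝ)) with hY
  have hY1 : 1 ≤ Y := Real.one_le_rpow hy (by positivity)
  have h := card_le_of_abs_sub_le (box F y) (fun _ => 0) (fun _ => Y) (fun _ => by linarith)
    (fun a ha σ => by
      have := ((boxSet_finite (F := F) y).mem_toFinset.mp ha) σ
      rw [sub_zero, abs_of_nonneg this.1]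
      exact this.2)
  rw [Finset.prod_const, Finset.card_univ] at h
  calc ((box F y).card : ℝ) ≤ (2 * Y + 1) ^ Fintype.card (F →+* ℝ) := h
    _ ≤ (3 * Y) ^ Fintype.card (F →+* ℝ) := by gcongr; linarith
    _ = _ := by rw [mul_pow, hY, rpow_one_div_pow_card (by linarith)]

omit [IsTotallyReal F] in
theorem boxSize_le {K Y : ℝ} (hY : 1 ≤ Y) {h : F} (hpos : ∀ σ : F →+* ℝ, 0 < σ h)
    (hone : ∀ σ : F →+* ℝ, 1 ≤ K * σ h) :
    boxSize Y h ≤ (2 * √K + 1) ^ Fintype.card (F →+* ℝ) * √Y ^ Fintype.card (F →+* ℝ) := by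
  rw [← mul_pow, boxSize, ← Finset.card_univ, ← Finset.prod_const]
  refine Finset.prod_le_prod (fun _ _ => by positivity) fun σ _ => ?_
  have hK : 0 ≤ K := (pos_of_mul_pos_left (one_pos.trans_le (hone σ)) (hpos σ).le).le
  have h1 : √(Y / σ h) ≤ √K * √Y := by
    rw [← Real.sqrt_mul hK]
    refine Real.sqrt_le_sqrt ?_
    rw [div_le_iff₀ (hpos σ)]
    nlinarith [hone σ]
  have h2 : 1 ≤ √Y := Real.one_le_sqrt.mpr hY
  nlinarith

/-- The vectors proportional to the first basis vector, where `h₁ x₁² = ℓ₁ ℓ₂²`: if `ℓ₁ ≠ 0` then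
`x₁` determines `ℓ₂`, which is totally nonnegative, and otherwise `x₁ = 0`. -/
theorem card_axis_le {K Y z y₂ : ℝ} (hz : Y ^ Fintype.card (F →+* ℝ) = z) (hY : 1 ≤ Y)
    (hy₂ : 1 ≤ y₂) (hyz : y₂ ≤ √z) {h₀ : F} (hpos : ∀ σ : F →+* ℝ, 0 < σ h₀)
    (hone : ∀ σ : F →+* ℝ, 1 ≤ K * σ h₀) {ℓ₁ : 𝓞 F} (T : Finset (𝓞 F × 𝓞 F))
    (hT : ∀ p ∈ T, h₀ * (p.1 : F) ^ 2 = (ℓ₁ : F) * (p.2 : F) ^ 2 ∧ p.2 ∈ box F y₂ ∧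
      ∀ σ : F →+* ℝ, σ (h₀ * (p.1 : F) ^ 2) ≤ Y) :
    (T.card : ℝ) ≤ ((2 * √K + 1) ^ Fintype.card (F →+* ℝ) + 3 ^ Fintype.card (F →+* ℝ)) * √z := by
  classical
  set d := Fintype.card (F →+* ℝ) with hd
  have hh₀ : h₀ ≠ 0 := by
    rintro rfl
    simpa using hpos (Classical.arbitrary _)
  by_cases hℓ : ℓ₁ = 0
  · have hinj : Set.InjOn Prod.snd (T : Set (𝓞 F × 𝓞 F)) := by
      have hzero : ∀ p ∈ T, p.1 = 0 := fun p hp => by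
        have := (hT p hp).1
        rw [hℓ] at this
        simpa [hh₀] using this
      intro p hp q hq e
      exact Prod.ext ((hzero p hp).trans (hzero q hq).symm) e
    have h1 : T.card ≤ (box F y₂).card := Finset.card_le_card_of_injOn _
      (fun p hp => (hT p hp).2.1) hinj
    calc (T.card : ℝ) ≤ (box F y₂).card := by exact_mod_cast h1
      _ ≤ 3 ^ d * y₂ := card_box_le hy₂
      _ ≤ 3 ^ d * √z := by gcongr
      _ ≤ _ := mul_le_mul_of_nonneg_right (le_add_of_nonneg_left (by positivity))
          (Real.sqrt_nonneg _)
  · have hinj : Set.InjOn Prod.fst (T : Set (𝓞 F × 𝓞 F)) := by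
      intro p hp q hq e
      have h1 := (hT p hp).1
      have h2 := (hT q hq).1
      rw [e, h2] at h1
      have hℓ' : (ℓ₁ : F) ≠ 0 := by simpa using hℓ
      have h3 := mul_left_cancel₀ hℓ' h1
      have σ : F →+* ℝ := Classical.arbitrary _
      have hp2 := (((boxSet_finite (F := F) y₂).mem_toFinset.mp (hT p hp).2.1) σ).1
      have hq2 := (((boxSet_finite (F := F) y₂).mem_toFinset.mp (hT q hq).2.1) σ).1
      have h4 : σ p.2 ^ 2 = σ q.2 ^ 2 :=
        (map_pow σ _ 2).symm.trans ((congr_arg σ h3.symm).trans (map_pow σ _ 2))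
      have h5 := (pow_left_inj₀ hp2 hq2 two_ne_zero).mp h4
      exact Prod.ext e (RingOfIntegers.ext (σ.injective h5))
    rw [← Finset.card_image_of_injOn hinj]
    have h1 : ((T.image Prod.fst).card : ℝ) ≤ boxSize Y h₀ := by
      refine card_le_boxSize hpos 0 _ fun a ha σ => ?_
      obtain ⟨p, hp, rfl⟩ := Finset.mem_image.mp ha
      rw [add_zero]
      exact (hT p hp).2.2 σ
    have h2 : √Y ^ d = √z := by
      rw [← hz, Real.sqrt_eq_rpow, Real.sqrt_eq_rpow, ← Real.rpow_natCast, ← Real.rpow_natCast,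
        ← Real.rpow_mul (by linarith), ← Real.rpow_mul (by linarith), mul_comm]
    refine (h1.trans (boxSize_le hY hpos hone)).trans ?_
    rw [← hd, h2]
    exact mul_le_mul_of_nonneg_right (le_add_of_nonneg_right (by positivity)) (Real.sqrt_nonneg _)

/-- For a given nonzero triple, the equation `Q(x) = ℓ₁ ℓ₂²` in the first coordinate and `ℓ₂`
becomes a norm equation `D ℓ₂² - u² = m ≠ 0` upon completing the square. -/
theorem card_fibre_le {C ε K Y P : ℝ} (hP : 1 ≤ P)
    (hC : ∀ D m : 𝓞 F, D ≠ 0 → m ≠ 0 → (∀ σ : F →+* ℝ, |σ m| ≤ P) →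
      ∀ T : Finset (𝓞 F × 𝓞 F), (∀ p ∈ T, D * p.2 ^ 2 - p.1 ^ 2 = m ∧ ∀ σ : F →+* ℝ,
        |σ D| * σ p.2 ^ 2 ≤ P ∧ σ p.1 ^ 2 ≤ P) → (T.card : ℝ) ≤ C * P ^ ε)
    (hC0 : 0 ≤ C) (hYP : 4 * K * Y ≤ P)
    {B : Matrix (Fin 4) (Fin 4) (𝓞 F)} {h : Fin 4 → F} {c : Fin 4 → Fin 4 → F}
    (hB : IsReduced K B h c) (hs : B.IsSymm) (hpos : ∀ (σ : F →+* ℝ) (j : Fin 4), 0 < σ (h j))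
    (h0K : ∀ σ : F →+* ℝ, σ (h 0) ≤ K) {ℓ₁ : 𝓞 F} (hℓ₁ : ∀ σ : F →+* ℝ, 0 ≤ σ ℓ₁)
    {t : 𝓞 F × 𝓞 F × 𝓞 F} (ht : t ≠ 0) (T : Finset (Σ _ : 𝓞 F, Fin 4 → 𝓞 F))
    (hT : ∀ p ∈ T, eval B (fun i => (p.2 i : F)) = (ℓ₁ : F) * (p.1 : F) ^ 2 ∧
      (p.2 1, p.2 2, p.2 3) = t ∧ ∀ σ : F →+* ℝ, σ (ℓ₁ : F) * σ (p.1 : F) ^ 2 ≤ Y) :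
    (T.card : ℝ) ≤ C * P ^ ε := by
  classical
  rcases T.eq_empty_or_nonempty with rfl | ⟨p₀, hp₀⟩
  · simp only [Finset.card_empty, Nat.cast_zero]
    positivity
  have hB00 : (B 0 0 : F) = 2 * h 0 := by
    refine (congr_fun (congr_fun (hB.toField_eq hs) 0) 0).trans ?_
    simp [quasiDiagMatrix]
  have h00 : ∀ σ : F →+* ℝ, σ (B 0 0 : F) = 2 * σ (h 0) := fun σ => by
    rw [hB00, map_mul, map_ofNat]
  have hB0 : B 0 0 ≠ 0 := by
    intro h0
    have σ : F →+* ℝ := Classical.arbitrary _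
    have := h00 σ
    rw [h0] at this
    simp only [map_zero] at this
    linarith [hpos σ 0]
  let D : 𝓞 F := 2 * B 0 0 * ℓ₁
  let u : (Σ _ : 𝓞 F, Fin 4 → 𝓞 F) → 𝓞 F := fun p => (B *ᵥ p.2) 0
  have hkey : ∀ p ∈ T, ((D * p.1 ^ 2 - u p ^ 2 : 𝓞 F) : F) = 4 * h 0 * tailDiag h c t.1 t.2.1 t.2.2 := by
    intro p hp
    obtain ⟨h1, h2, -⟩ := hT p hp
    have h3 := hB.four_mul_eval hs p.2
    rw [h1] at h3
    rw [← h2, ← h3]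
    simp only [D, u, map_sub, map_mul, map_pow, map_ofNat]
    ring
  have htail : ∀ σ : F →+* ℝ, 0 < σ (4 * h 0 * tailDiag h c t.1 t.2.1 t.2.2) := fun σ => by
    have h1 : 0 < σ (tailDiag h c t.1 t.2.1 t.2.2) := by
      refine tailDiag_pos (hpos σ) c fun h0 => ht ?_
      obtain ⟨a, b, e⟩ := h0
      exact Prod.ext (RingOfIntegers.ext a) (Prod.ext (RingOfIntegers.ext b) (RingOfIntegers.ext e))
    have h2 := hpos σ 0
    simp only [map_mul, map_ofNat]
    positivity
  have hsub : ∀ (σ : F →+* ℝ) (p : Σ _ : 𝓞 F, Fin 4 → 𝓞 F),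
      σ ((D * p.1 ^ 2 - u p ^ 2 : 𝓞 F) : F) = σ (D : F) * σ (p.1 : F) ^ 2 - σ (u p : F) ^ 2 :=
    fun σ p => by simp only [map_sub, map_mul, map_pow]
  have hDσ : ∀ σ : F →+* ℝ, σ (D : F) = 4 * σ (h 0) * σ (ℓ₁ : F) := fun σ => by
    simp only [D, map_mul, map_ofNat]
    rw [h00]
    ring
  have hD0 : ∀ σ : F →+* ℝ, 0 ≤ σ (D : F) := fun σ => by
    rw [hDσ]
    exact mul_nonneg (by linarith [hpos σ 0]) (hℓ₁ σ)
  have hDw : ∀ p ∈ T, ∀ σ : F →+* ℝ, σ (D : F) * σ (p.1 : F) ^ 2 ≤ P := fun p hp σ => by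
    rw [hDσ, mul_assoc]
    refine le_trans ?_ hYP
    have h1 := (hT p hp).2.2 σ
    have h2 := h0K σ
    have h3 := hpos σ 0
    exact mul_le_mul (by linarith) h1 (mul_nonneg (hℓ₁ σ) (sq_nonneg _)) (by linarith)
  have hsubpos : ∀ p ∈ T, ∀ σ : F →+* ℝ,
      0 < σ (D : F) * σ (p.1 : F) ^ 2 - σ (u p : F) ^ 2 := fun p hp σ => by
    rw [← hsub, hkey p hp]
    exact htail σ
  let m : 𝓞 F := D * p₀.1 ^ 2 - u p₀ ^ 2
  have hinj : Set.InjOn (fun p : Σ _ : 𝓞 F, Fin 4 → 𝓞 F => (u p, p.1)) T := by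
    rintro ⟨a, x⟩ hp ⟨b, y⟩ hq e
    obtain ⟨e1, rfl⟩ := Prod.ext_iff.mp e
    have h1 := (hT _ hp).2.1.trans (hT _ hq).2.1.symm
    simp only [Prod.mk.injEq] at h1
    obtain ⟨h1, h2, h3⟩ := h1
    simp only [u, mulVec, dotProduct, Fin.sum_univ_four] at e1
    rw [h1, h2, h3] at e1
    have h4 : B 0 0 * x 0 = B 0 0 * y 0 := by linear_combination e1
    have h5 := mul_left_cancel₀ hB0 h4
    have h6 : x = y := by
      ext i
      fin_cases i
      · exact congr_arg _ h5
      · exact congr_arg _ h1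
      · exact congr_arg _ h2
      · exact congr_arg _ h3
    rw [h6]
  have hσ₀ : F →+* ℝ := Classical.arbitrary _
  have hDne : D ≠ 0 := fun h0 => by
    have := hsubpos p₀ hp₀ hσ₀
    rw [h0] at this
    simp only [map_zero, zero_mul, zero_sub] at this
    linarith [sq_nonneg (hσ₀ (u p₀ : F))]
  have hmne : m ≠ 0 := fun h0 => by
    have h1 := hsubpos p₀ hp₀ hσ₀
    rw [← hsub, show D * p₀.1 ^ 2 - u p₀ ^ 2 = 0 from h0] at h1
    simp at h1
  rw [← Finset.card_image_of_injOn hinj]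
  refine hC D m hDne hmne (fun σ => ?_) _ fun q hq => ?_
  · have h1 := hsubpos p₀ hp₀ σ
    have h2 := hDw p₀ hp₀ σ
    have h3 : σ (m : F) = σ (D : F) * σ (p₀.1 : F) ^ 2 - σ (u p₀ : F) ^ 2 := hsub σ p₀
    rw [h3, abs_of_pos h1]
    linarith [sq_nonneg (σ (u p₀ : F))]
  · obtain ⟨p, hp, rfl⟩ := Finset.mem_image.mp hq
    refine ⟨RingOfIntegers.ext ((hkey p hp).trans (hkey p₀ hp₀).symm), fun σ => ⟨?_, ?_⟩⟩
    · rw [abs_of_nonneg (hD0 σ)]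
      exact hDw p hp σ
    · have h1 := hsubpos p hp σ
      have h2 := hDw p hp σ
      simp only
      linarith

end QForm

namespace QForm

variable {F : Type*} [Field F] [NumberField F] [IsTotallyReal F]

/-- The lower bounds for `N(h₁ h₂ h₃ h₄)` and `N(h₁ h₂ h₃)` by the determinant and the level. -/
theorem normDet_le_of_reduced {K : ℝ} (hK : 0 < K) {A : Matrix (Fin 4) (Fin 4) (𝓞 F)}
    (hA : A.IsSymm) (hdet : A.det ≠ 0) (U : Matrix (Fin 4) (Fin 4) (𝓞 F))
    {h : Fin 4 → F} {c : Fin 4 → Fin 4 → F} (hB : IsReduced K (Uᵀ * A * U) h c) :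
    normDet A ≤ absN (16 * (h 0 * h 1 * h 2 * h 3)) ∧
      normDet A ≤ absN (8 * (h 0 * h 1 * h 2)) * normLevel A := by
  have hs : (Uᵀ * A * U).IsSymm := by
    rw [Matrix.IsSymm, transpose_mul, transpose_mul, transpose_transpose, hA.eq, Matrix.mul_assoc]
  have σ : F →+* ℝ := Classical.arbitrary _
  have h0 : ∀ j, h j ≠ 0 := fun j hj => by
    have := hB.pos hK σ j
    rw [hj, map_zero] at this
    exact lt_irrefl _ this
  have h16 : (16 : F) ≠ 0 := by norm_num
  have h8 : (8 : F) ≠ 0 := by norm_num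
  constructor
  · rw [← hB.det_eq hs]
    refine normDet_le_absN_det A U fun hd => ?_
    have := hB.det_eq hs
    rw [hd] at this
    simp only [map_zero] at this
    exact (mul_ne_zero h16 (mul_ne_zero (mul_ne_zero (mul_ne_zero (h0 0) (h0 1)) (h0 2))
      (h0 3))) this.symm
  · have h1 := absN_two_mul_normDet_le hA hdet U 3 fun hd => by
      have := hB.adjugate_eq hs
      rw [hd] at this
      simp only [map_zero] at this
      exact (mul_ne_zero h8 (mul_ne_zero (mul_ne_zero (h0 0) (h0 1)) (h0 2))) this.symm
    rw [hB.adjugate_eq hs] at h1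
    refine le_trans ?_ h1
    exact le_mul_of_one_le_left (Nat.cast_nonneg _) one_le_absN_two

variable (F) in
/-- The bound for a fixed `ℓ₁`. The bounds `1 ≤ y₁` and `1 ≤ y₂` are not strict, so that
`y₁ = ℓ₁ = 1` is allowed, which gives the sum of `r(ℓ²)`. -/
theorem exists_sum_r_mul_sq_le {K : ℝ} (hK : 0 < K) {ε : ℝ} (hε : 0 < ε) : ∃ C : ℝ, 0 < C ∧
    ∀ A : Matrix (Fin 4) (Fin 4) (𝓞 F), IsIntegralForm A → IsTotallyPosDef A →
      FirstCoeffBounded K A → ∀ y₁ y₂ : ℝ, 1 ≤ y₁ → 1 ≤ y₂ → ∀ ℓ₁ ∈ boxSet F y₁,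
        ∑ ℓ₂ ∈ box F y₂, (r A (ℓ₁ * ℓ₂ ^ 2) : ℝ)
          ≤ C * mainTerm A (y₁ * y₂ ^ 2) * (y₁ * y₂ ^ 2) ^ ε := by
  classical
  obtain ⟨C₁, hC₁, hbinary⟩ := exists_card_sq_sub_sq_le F hε
  obtain ⟨C₂, hC₂, hboxes⟩ := exists_boxSize_mul_le (F := F) hK
  set d := Fintype.card (F →+* ℝ) with hd
  set C₃ : ℝ := (2 * √K + 1) ^ d + 3 ^ d with hC₃
  refine ⟨C₁ * (4 * (K + 1)) ^ ε * C₂ + C₃, by positivity,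
    fun A hA hpd hfirst y₁ y₂ hy₁ hy₂ ℓ₁ hℓ₁ => ?_⟩
  obtain ⟨B, h, c, ⟨U, rfl⟩, hB, h0K⟩ := hfirst
  set B := (U : Matrix (Fin 4) (Fin 4) (𝓞 F))ᵀ * A * U with hBdef
  have hdet := hpd.det_ne_zero
  have hΔ := one_le_normDet hdet
  have hs : B.IsSymm := by
    rw [hBdef, Matrix.IsSymm, transpose_mul, transpose_mul, transpose_transpose, hA.symm.eq,
      Matrix.mul_assoc]
  obtain ⟨hN1, hN2⟩ := normDet_le_of_reduced hK hA.symm hdet _ hB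
  have hpos := hB.pos hK
  set z := y₁ * y₂ ^ 2 with hz
  have hz1 : 1 ≤ z := one_le_mul_of_one_le_of_one_le hy₁ (one_le_pow₀ hy₂)
  have hz0 : 0 < z := by linarith
  set Y := z ^ (1 / (Module.finrank ℚ F : ℝ)) with hY
  have hY1 : 1 ≤ Y := Real.one_le_rpow hz1 (by positivity)
  have hYd : Y ^ d = z := rpow_one_div_pow_card hz0.le
  have hYz : Y ≤ z := by
    rw [← hYd]
    exact le_self_pow₀ hY1 Fintype.card_ne_zero
  have hfin : ∀ ℓ, (reps B ℓ).Finite := fun ℓ => by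
    have h1 := reps_finite hpd ℓ
    rw [reps_equivalent A U ℓ] at h1
    exact h1.of_finite_image (mulVec_unit_injective U).injOn
  have hr : ∀ ℓ, r A ℓ = (hfin ℓ).toFinset.card := fun ℓ => by
    rw [r, reps_equivalent A U ℓ, Set.ncard_image_of_injective _ (mulVec_unit_injective U),
      Set.ncard_eq_toFinset_card _ (hfin ℓ)]
  set S : Finset (Σ _ : 𝓞 F, Fin 4 → 𝓞 F) :=
    (box F y₂).sigma fun ℓ => (hfin (ℓ₁ * ℓ ^ 2)).toFinset with hS
  have hsum : ∑ ℓ₂ ∈ box F y₂, (r A (ℓ₁ * ℓ₂ ^ 2) : ℝ) = S.card := by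
    rw [hS, Finset.card_sigma, Nat.cast_sum]
    exact Finset.sum_congr rfl fun ℓ _ => by rw [hr]
  have hSmem : ∀ p ∈ S, p.1 ∈ box F y₂ ∧
      eval B (fun i => (p.2 i : F)) = (ℓ₁ : F) * (p.1 : F) ^ 2 ∧
      ∀ σ : F →+* ℝ, σ (ℓ₁ : F) * σ (p.1 : F) ^ 2 ≤ Y := fun p hp => by
    obtain ⟨hp1, hp2⟩ := Finset.mem_sigma.mp hp
    refine ⟨hp1, ?_, fun σ => ?_⟩
    · have h1 : eval B (fun i => (p.2 i : F)) = ((ℓ₁ * p.1 ^ 2 : 𝓞 F) : F) :=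
        (hfin (ℓ₁ * p.1 ^ 2)).mem_toFinset.mp hp2
      rw [h1]
      simp only [map_mul, map_pow]
    · obtain ⟨h1, h2⟩ := hℓ₁ σ
      obtain ⟨h3, h4⟩ := ((boxSet_finite (F := F) y₂).mem_toFinset.mp hp1) σ
      have hY' : Y = y₁ ^ (1 / (Module.finrank ℚ F : ℝ)) *
          (y₂ ^ (1 / (Module.finrank ℚ F : ℝ))) ^ 2 := by
        rw [hY, hz, Real.mul_rpow (by linarith) (by positivity), ← Real.rpow_natCast y₂ 2,
          ← Real.rpow_mul (by linarith), ← Real.rpow_natCast (y₂ ^ _), ← Real.rpow_mul (by linarith),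
          mul_comm (1 / (Module.finrank ℚ F : ℝ))]
      rw [hY']
      exact mul_le_mul h2 (pow_le_pow_left₀ h3 h4 2) (sq_nonneg _) (by positivity)
  have hσeval : ∀ p ∈ S, ∀ σ : F →+* ℝ, σ (eval B (fun i => (p.2 i : F))) ≤ Y := fun p hp σ => by
    obtain ⟨-, h1, h2⟩ := hSmem p hp
    rw [h1, map_mul, map_pow]
    exact h2 σ
  let g : (Σ _ : 𝓞 F, Fin 4 → 𝓞 F) → 𝓞 F × 𝓞 F × 𝓞 F := fun p => (p.2 1, p.2 2, p.2 3)
  set P : ℝ := 4 * (K + 1) * z with hP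
  have hP1 : 1 ≤ P := by rw [hP]; nlinarith
  -- the points off the first axis, fibred over the last three coordinates
  have hS1 : (({p ∈ S | g p ≠ 0}.card : ℕ) : ℝ) ≤ C₁ * P ^ ε * (C₂ * mainTerm A z) := by
    have hcard : {p ∈ S | g p ≠ 0}.card
        ≤ ⌊C₁ * P ^ ε⌋₊ * (({p ∈ S | g p ≠ 0}).image g).card := by
      refine Finset.card_le_mul_card_image _ _ fun t ht => Nat.le_floor ?_
      obtain ⟨p₀, hp₀, rfl⟩ := Finset.mem_image.mp ht
      refine card_fibre_le (Y := Y) hP1 (hbinary P hP1) hC₁.le ?_ hB hs hpos (fun σ => (h0K σ).2)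
        (fun σ => (hℓ₁ σ).1) (Finset.mem_filter.mp hp₀).2 _ fun p hp => ?_
      · rw [hP]
        nlinarith
      · obtain ⟨hp, hpt⟩ := Finset.mem_filter.mp hp
        obtain ⟨-, h1, h2⟩ := hSmem p (Finset.mem_filter.mp hp).1
        exact ⟨h1, hpt, h2⟩
    have himg : ((({p ∈ S | g p ≠ 0}).image g).card : ℝ) ≤ C₂ * mainTerm A z := by
      refine (card_triples_le (Y := Y) hpos c _ fun t ht σ => ?_).trans
        (hboxes A B h c hB (fun σ => (h0K σ).2) hΔ hN1 hN2 z hz1)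
      obtain ⟨p, hp, rfl⟩ := Finset.mem_image.mp ht
      have h1 := hσeval p (Finset.mem_filter.mp hp).1 σ
      rw [hB.eval_eq_quasiDiag, quasiDiag, map_add, map_mul, map_pow] at h1
      refine le_trans ?_ h1
      exact le_add_of_nonneg_left (mul_nonneg (hpos σ 0).le (sq_nonneg _))
    calc (({p ∈ S | g p ≠ 0}.card : ℕ) : ℝ)
        ≤ (⌊C₁ * P ^ ε⌋₊ : ℝ) * (({p ∈ S | g p ≠ 0}).image g).card := by exact_mod_cast hcard
      _ ≤ C₁ * P ^ ε * (C₂ * mainTerm A z) :=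
        mul_le_mul (Nat.floor_le (by positivity)) himg (by positivity) (by positivity)
  -- the points on the first axis
  have hS0 : (({p ∈ S | ¬ g p ≠ 0}.card : ℕ) : ℝ) ≤ C₃ * z ^ (1 / 2 : ℝ) := by
    have hzero : ∀ p ∈ S, g p = 0 → p.2 1 = 0 ∧ p.2 2 = 0 ∧ p.2 3 = 0 := fun p _ hp => by
      simpa [g, Prod.ext_iff] using hp
    have heval : ∀ p ∈ S, g p = 0 →
        eval B (fun i => (p.2 i : F)) = h 0 * (p.2 0 : F) ^ 2 := fun p hp hgp => by
      obtain ⟨h1, h2, h3⟩ := hzero p hp hgp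
      rw [hB.eval_eq_quasiDiag, quasiDiag, tailDiag, h1, h2, h3]
      simp
    have hinj : Set.InjOn (fun p : Σ _ : 𝓞 F, Fin 4 → 𝓞 F => (p.2 0, p.1))
        ({p ∈ S | ¬ g p ≠ 0} : Finset _) := by
      rintro ⟨a, x⟩ hp ⟨b, y⟩ hq e
      obtain ⟨e0, rfl⟩ := Prod.ext_iff.mp e
      obtain ⟨hp, hgp⟩ := Finset.mem_filter.mp hp
      obtain ⟨hq, hgq⟩ := Finset.mem_filter.mp hq
      obtain ⟨p1, p2, p3⟩ := hzero _ hp (not_not.mp hgp)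
      obtain ⟨q1, q2, q3⟩ := hzero _ hq (not_not.mp hgq)
      have : x = y := by
        ext i
        fin_cases i
        · exact congr_arg _ e0
        · exact congr_arg _ (p1.trans q1.symm)
        · exact congr_arg _ (p2.trans q2.symm)
        · exact congr_arg _ (p3.trans q3.symm)
      rw [this]
    rw [← Finset.card_image_of_injOn hinj, ← Real.sqrt_eq_rpow]
    have hyz : y₂ ≤ √z := by
      apply Real.le_sqrt_of_sq_le
      rw [hz]
      exact le_mul_of_one_le_left (sq_nonneg _) hy₁
    refine card_axis_le (ℓ₁ := ℓ₁) hYd hY1 hy₂ hyz (fun σ => hpos σ 0) (fun σ => hB.one_le σ 0) _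
      fun q hq => ?_
    obtain ⟨p, hp, rfl⟩ := Finset.mem_image.mp hq
    obtain ⟨hp, hgp⟩ := Finset.mem_filter.mp hp
    obtain ⟨h1, h2, h3⟩ := hSmem p hp
    have h4 := heval p hp (not_not.mp hgp)
    refine ⟨h4.symm.trans h2, h1, fun σ => ?_⟩
    exact (congr_arg σ h4).symm.trans_le (hσeval p hp σ)
  have hm1 : z ^ (1 / 2 : ℝ) ≤ mainTerm A z := by
    have hN : 0 ≤ normLevel A := Nat.cast_nonneg _
    have : 0 ≤ z ^ (3 / 2 : ℝ) / normDet A ^ (1 / 2 : ℝ)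
      + z / (normDet A / normLevel A) ^ (1 / 2 : ℝ) := by positivity
    rw [mainTerm]
    linarith
  have hm0 : 0 ≤ mainTerm A z := le_trans (by positivity) hm1
  have hzε : 1 ≤ z ^ ε := Real.one_le_rpow hz1 hε.le
  have hPε : P ^ ε = (4 * (K + 1)) ^ ε * z ^ ε := Real.mul_rpow (by positivity) hz0.le
  rw [hsum, ← Finset.card_filter_add_card_filter_not (s := S) (fun p => g p ≠ 0), Nat.cast_add]
  calc (({p ∈ S | g p ≠ 0}.card : ℕ) : ℝ) + (({p ∈ S | ¬ g p ≠ 0}.card : ℕ) : ℝ)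
      ≤ C₁ * P ^ ε * (C₂ * mainTerm A z) + C₃ * z ^ (1 / 2 : ℝ) := add_le_add hS1 hS0
    _ ≤ C₁ * P ^ ε * (C₂ * mainTerm A z) + C₃ * (mainTerm A z * z ^ ε) := by
        have : z ^ (1 / 2 : ℝ) ≤ mainTerm A z * z ^ ε :=
          hm1.trans (le_mul_of_one_le_right hm0 hzε)
        gcongr
    _ = _ := by rw [hPε]; ring

theorem mul_rpow_half_le {A : Matrix (Fin 4) (Fin 4) (𝓞 F)} (hA : A.det ≠ 0) {y₁ y₂ ε : ℝ}
    (hy₁ : 1 ≤ y₁) (hy₂ : 1 ≤ y₂) (hε : 0 < ε) :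
    (y₁ * y₂ ^ 2) ^ (ε / 2) ≤ (y₁ * y₂ * normDet A) ^ ε := by
  have hΔ := one_le_normDet hA
  have h1 : 1 ≤ y₁ * y₂ := one_le_mul_of_one_le_of_one_le hy₁ hy₂
  have h2 : y₁ * y₂ ^ 2 ≤ (y₁ * y₂ * normDet A) ^ 2 := by
    calc y₁ * y₂ ^ 2 ≤ y₁ ^ 2 * y₂ ^ 2 := by
          refine mul_le_mul_of_nonneg_right ?_ (sq_nonneg _)
          exact le_self_pow₀ hy₁ two_ne_zero
      _ = (y₁ * y₂) ^ 2 := by ring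
      _ ≤ _ := pow_le_pow_left₀ (by linarith) (le_mul_of_one_le_right (by linarith) hΔ) 2
  refine (Real.rpow_le_rpow (by positivity) h2 (by positivity)).trans_eq ?_
  rw [← Real.rpow_natCast, ← Real.rpow_mul (by positivity)]
  congr 1
  push_cast
  ring

end QForm

theorem lemma2 (F : Type*) [Field F] [NumberField F] [NumberField.IsTotallyReal F] :
    (∃ C : ℝ, 0 < C ∧
      ∀ A : Matrix (Fin 4) (Fin 4) (𝓞 F), QForm.IsIntegralForm A → QForm.IsTotallyPosDef A →
        ∀ y : ℝ, 1 < y →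
          ∑ ℓ ∈ QForm.box F y, (QForm.r A ℓ : ℝ) ≤
            C * (y ^ 2 / QForm.normDet A ^ (1 / 2 : ℝ)
              + y ^ (3 / 2 : ℝ) / (QForm.normDet A / QForm.normLevel A) ^ (1 / 2 : ℝ)
              + y)) ∧
    (∀ K : ℝ, 0 < K → ∀ ε : ℝ, 0 < ε → ∃ C : ℝ, 0 < C ∧
      ∀ A : Matrix (Fin 4) (Fin 4) (𝓞 F), QForm.IsIntegralForm A → QForm.IsTotallyPosDef A →
        QForm.FirstCoeffBounded K A →
          (∀ y₁ y₂ : ℝ, 1 < y₁ → 1 < y₂ →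
            ∑ ℓ₁ ∈ QForm.box F y₁, ∑ ℓ₂ ∈ QForm.box F y₂, (QForm.r A (ℓ₁ * ℓ₂ ^ 2) : ℝ) ≤
              C * (y₁ * ((y₁ * y₂ ^ 2) ^ (3 / 2 : ℝ) / QForm.normDet A ^ (1 / 2 : ℝ)
                  + y₁ * y₂ ^ 2 / (QForm.normDet A / QForm.normLevel A) ^ (1 / 2 : ℝ)
                  + (y₁ * y₂ ^ 2) ^ (1 / 2 : ℝ))
                * (y₁ * y₂ * QForm.normDet A) ^ ε)) ∧
          (∀ y : ℝ, 1 < y →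
            ∑ ℓ ∈ QForm.box F y, (QForm.r A (ℓ ^ 2) : ℝ) ≤
              C * ((y ^ 3 / QForm.normDet A ^ (1 / 2 : ℝ)
                  + y ^ 2 / (QForm.normDet A / QForm.normLevel A) ^ (1 / 2 : ℝ)
                  + y)
                * (y * QForm.normDet A) ^ ε))) := by
  refine ⟨QForm.sum_r_le F, fun K hK ε hε => ?_⟩
  obtain ⟨C, hC, hsum⟩ := QForm.exists_sum_r_mul_sq_le F hK (half_pos hε)
  refine ⟨3 ^ Fintype.card (F →+* ℝ) * C, by positivity, fun A hA hpd hfirst => ⟨?_, ?_⟩⟩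
  · intro y₁ y₂ hy₁ hy₂
    have hm : 0 ≤ QForm.mainTerm A (y₁ * y₂ ^ 2) := by
      have : 0 ≤ QForm.normLevel A := Nat.cast_nonneg _
      have : 0 ≤ QForm.normDet A := Nat.cast_nonneg _
      rw [QForm.mainTerm]
      positivity
    have hle := QForm.mul_rpow_half_le hpd.det_ne_zero hy₁.le hy₂.le hε
    calc ∑ ℓ₁ ∈ QForm.box F y₁, ∑ ℓ₂ ∈ QForm.box F y₂, (QForm.r A (ℓ₁ * ℓ₂ ^ 2) : ℝ)
        ≤ ∑ ℓ₁ ∈ QForm.box F y₁,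
          C * QForm.mainTerm A (y₁ * y₂ ^ 2) * (y₁ * y₂ ^ 2) ^ (ε / 2) :=
          Finset.sum_le_sum fun ℓ₁ hℓ₁ => hsum A hA hpd hfirst y₁ y₂ hy₁.le hy₂.le ℓ₁
            ((QForm.boxSet_finite (F := F) y₁).mem_toFinset.mp hℓ₁)
      _ = (QForm.box F y₁).card * (C * QForm.mainTerm A (y₁ * y₂ ^ 2) *
          (y₁ * y₂ ^ 2) ^ (ε / 2)) := by rw [Finset.sum_const, nsmul_eq_mul]
      _ ≤ (3 ^ Fintype.card (F →+* ℝ) * y₁) * (C * QForm.mainTerm A (y₁ * y₂ ^ 2) *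
          (y₁ * y₂ * QForm.normDet A) ^ ε) := by
          refine mul_le_mul (QForm.card_box_le hy₁.le)
            (mul_le_mul_of_nonneg_left hle (by positivity)) (by positivity) (by positivity)
      _ = _ := by rw [QForm.mainTerm]; ring
  · intro y hy
    have hy0 : 0 < y := by linarith
    have h1 := hsum A hA hpd hfirst 1 y le_rfl hy.le 1 fun σ => by simp
    have hle := QForm.mul_rpow_half_le hpd.det_ne_zero le_rfl hy.le hε
    simp only [one_mul] at h1 hle
    have e1 : (y ^ 2) ^ (3 / 2 : ℝ) = y ^ 3 := by
      rw [← Real.rpow_natCast, ← Real.rpow_natCast, ← Real.rpow_mul hy0.le]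
      norm_num
    have e2 : (y ^ 2) ^ (1 / 2 : ℝ) = y := by
      rw [← Real.sqrt_eq_rpow, Real.sqrt_sq hy0.le]
    have hm : QForm.mainTerm A (y ^ 2) = y ^ 3 / QForm.normDet A ^ (1 / 2 : ℝ)
        + y ^ 2 / (QForm.normDet A / QForm.normLevel A) ^ (1 / 2 : ℝ) + y := by
      rw [QForm.mainTerm, e1, e2]
    have hm0 : 0 ≤ QForm.mainTerm A (y ^ 2) := by
      have : 0 ≤ QForm.normLevel A := Nat.cast_nonneg _
      have : 0 ≤ QForm.normDet A := Nat.cast_nonneg _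
      rw [hm]
      positivity
    rw [← hm]
    calc ∑ ℓ ∈ QForm.box F y, (QForm.r A (ℓ ^ 2) : ℝ)
        ≤ C * QForm.mainTerm A (y ^ 2) * (y ^ 2) ^ (ε / 2) := h1
      _ ≤ C * QForm.mainTerm A (y ^ 2) * (y * QForm.normDet A) ^ ε :=
          mul_le_mul_of_nonneg_left hle (by positivity)
      _ ≤ 3 ^ Fintype.card (F →+* ℝ) *
          (C * QForm.mainTerm A (y ^ 2) * (y * QForm.normDet A) ^ ε) := by
          refine le_mul_of_one_le_left ?_ (one_le_pow₀ (by norm_num))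
          have : 0 ≤ QForm.normDet A := Nat.cast_nonneg _
          positivity
      _ = _ := by ring
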